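/- \textbf{Setting.} Let $T>0$, let $U\subset\mathbb R^m$ be compact and connected (and nonempty), let $\xi\in\mathbb R^n$, and let $f:[0,T]\times\mathbb R^n\times\mathbb R^m\to\mathbb R^n$ and $\Psi:\mathbb R^n\to\mathbb R$ be such that $\Psi$, $\nabla\Psi$, $f$, $\partial f/\partial x$ and $\partial f/\partial u$ exist and are Lipschitz continuous with a common constant $L>0$ (for $f$ and its derivatives: on $[0,T]\times\mathbb R^n\times U$, jointly in $(t,x,u)$). A relaxed input is a measurable family $\mu=(\mu_t)_{t\in[0,T]}$ of Borel probability measures on $\mathbb R^m$ with $\operatorname{supp}\mu_t\subset U$ for a.e. $t$. Its trajectory $x^{(\mu)}$ solves $x(0)=\xi$, $\dot x(t)=\int f(t,x(t),u)\,d\mu_t(u)$, and the costate $p$ of a pair $(x,\mu)$ solves $p(T)=\nabla\Psi(x(T))$, $\dot p(t)=-\int \frac{\partial f}{\partial x}(t,x(t),u)^{\top}d\mu_t(u)\,p(t)$. The relaxed problem $\mathbf P$ is to minimize $\Psi(x(T))$ over the set $\mathcal D$ of all pairs $(x^{(\mu)},\mu)$. Pairs $(x,\mu)$ carry the product of the topology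 of uniform convergence of $x\in C([0,T],\mathbb R^n)$ and the weak topology of relaxed inputs ($\mu^N\to\mu$ iff $\int_0^T\!\int\varphi(t,u)\,d\mu^N_t(u)\,dt\to\int_0^T\!\int\varphi(t,u)\,d\mu_t(u)\,dt$ for all bounded continuous $\varphi$). A variation of $\mu$ is a measurable family $\delta\mu=(\delta\mu_t)$ of signed measures with $\delta\mu_t+\mu_t\ge0$ and $\int d\delta\mu_t=0$ for a.e. $t$. Put $$\theta_h(x,\mu)=\inf_{\delta\mu}\int_0^T p(t)^{\top}\!\int f(t,x(t),u)\,d\delta\mu_t(u)\,dt\quad\text{subject to } \operatorname{supp}(\delta\mu_t+\mu_t)\subset U\ \text{for a.e. } t .$$ For each $N$ let $u_{N,1},\dots,u_{N,N}$ be independent random points with common law $\nu$, a probability distribution whose support is $U$ (for instance the uniform distribution on $U$, whenever every nonempty relatively open subset of $U$ has positive volume); nothing is assumed about the dependence between different $N$. Let $\mathcal D_N$ be the set of pairs $(x^{(\mu)},\mu)\in\mathcal D$ with $\mu_t=\sum_{i=1}^N w_i(t)\,\delta_{u_{N,i}}$ for a.e. $t$, where the $w_i$ are measurable, $w_i\ge0$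 and $\sum_i w_i=1$, and let $\mathbf P_N$ be the problem of minimizing $\Psi(x(T))$ over $\mathcal D_N$. On $\mathcal D_N$ let $\theta_{N,h}$ be defined by the same formula as $\theta_h$, with the constraint $\operatorname{supp}(\delta\mu_t+\mu_t)\subset U$ replaced by $\operatorname{supp}(\delta\mu_t)\subset\operatorname{supp}(\mu_t)$, and let $\hat\theta_{N,h}$ be defined with $\operatorname{supp}(\delta\mu_t)\subset\{u_{N,1},\dots,u_{N,N}\}$ instead (the two agree when all weights are positive). Functions $F_N:\mathcal D_N\to\mathbb R$ epi-converge to $F:\mathcal D\to\mathbb R$ if (a) each $y\in\mathcal D$ is the limit of points $y_N\in\mathcal D_N$ ($N$ large) with $\limsup_N F_N(y_N)\le F(y)$; and (b) whenever $y_j\in\mathcal D_{N_j}$, $N_1<N_2<\cdots$ and $y_j\to y$, then $y\in\mathcal D$ and $\liminf_j F_{N_j}(y_j)\ge F(y)$. A function $\theta$ with values in $(-\infty,0]$ on the feasible set is an optimality function of a problem if it vanishes at every minimizer. \textbf{Theorem.} Every relaxed input has a unique trajectory, and every pair $(x,\mu)$, with $x$ continuous, has a unique costate. With probability one the following hold as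 $N\to\infty$: \begin{enumerate} \item $\theta_{N,h}$ epi-converges to $\theta_h$; \item $\hat\theta_{N,h}$ epi-converges to $\theta_h$; \item $(\mathbf P_N,\hat\theta_{N,h})$ are consistent approximations of $(\mathbf P,\theta_h)$ in Polak's sense: $\hat\theta_{N,h}$ and $\theta_h$ are optimality functions of $\mathbf P_N$ (for every $N$) and of $\mathbf P$; the costs of $\mathbf P_N$ epi-converge to the cost of $\mathbf P$; and $\limsup_j\hat\theta_{N_j,h}(y_j)\le\theta_h(y)$ whenever $y_j\in\mathcal D_{N_j}$, $N_1<N_2<\cdots$ and $y_j\to y$. \end{enumerate} -/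

import Mathlib

open MeasureTheory ProbabilityTheory Filter Topology

noncomputable section

/-- The Euclidean space `ℝⁿ`. -/
abbrev RVec (n : ℕ) := EuclideanSpace ℝ (Fin n)

/-! ### Epi-convergence and consistent approximations -/

/-- Epi-convergence of the constrained problems `min {F N y | y ∈ D N}` to the constrained problem
`min {F' y | y ∈ D'}`: every point of `D'` has a recovery sequence, and the lower bound (together
with feasibility of the limit) holds along every convergent subsequence of feasible points. -/
structure EpiConverges {Y : Type*} [TopologicalSpace Y]
    (D : ℕ → Set Y) (F : ℕ → Y → EReal) (D' : Set Y) (F' : Y → EReal) : Prop where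
  recovery : ∀ y ∈ D', ∃ a : ℕ → Y, (∀ᶠ N in atTop, a N ∈ D N) ∧ Tendsto a atTop (𝓝 y) ∧
    limsup (fun N => F N (a N)) atTop ≤ F' y
  lower : ∀ (k : ℕ → ℕ), StrictMono k → ∀ (a : ℕ → Y) (y : Y), (∀ j, a j ∈ D (k j)) →
    Tendsto a atTop (𝓝 y) → y ∈ D' ∧ F' y ≤ liminf (fun j => F (k j) (a j)) atTop

/-- `θ : D → (-∞, 0]` is an optimality function for `min {F y | y ∈ D}`: it vanishes at every
minimizer. -/
structure IsOptimalityFunction {Y : Type*} (D : Set Y) (F θ : Y → EReal) : Prop where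
  nonpos : ∀ y ∈ D, θ y ≤ 0
  ne_bot : ∀ y ∈ D, θ y ≠ ⊥
  eq_zero : ∀ y ∈ D, IsMinOn F D y → θ y = 0

/-- Consistent approximations: the pairs of problems `min {F N y | y ∈ D N}` and optimality
functions `θ N` are consistent approximations to the pair of `min {F' y | y ∈ D'}` and `θ'`. -/
structure ConsistentApproximations {Y : Type*} [TopologicalSpace Y]
    (D : ℕ → Set Y) (F θ : ℕ → Y → EReal) (D' : Set Y) (F' θ' : Y → EReal) : Prop where
  optimality_approx : ∀ N, IsOptimalityFunction (D N) (F N) (θ N)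
  optimality_limit : IsOptimalityFunction D' F' θ'
  epi : EpiConverges D F D' F'
  upper : ∀ (k : ℕ → ℕ), StrictMono k → ∀ (a : ℕ → Y) (y : Y), (∀ j, a j ∈ D (k j)) →
    Tendsto a atTop (𝓝 y) → limsup (fun j => θ (k j) (a j)) atTop ≤ θ' y

/-! ### Signed measures -/

/-- The support of a signed measure, that is, of its total variation. -/
def signedSupport {m : ℕ} (δ : SignedMeasure (RVec m)) : Set (RVec m) :=
  δ.totalVariation.support

/-- The integral `∫ g dδ = ∫ g dδ⁺ - ∫ g dδ⁻` with respect to a signed measure. -/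
def signedIntegral {m n : ℕ} (δ : SignedMeasure (RVec m)) (g : RVec m → RVec n) : RVec n :=
  (∫ u, g u ∂δ.toJordanDecomposition.posPart) - ∫ u, g u ∂δ.toJordanDecomposition.negPart

/-! ### The relaxed optimal control problem -/

/-- The data of the control problem on `[0, T]` with dynamics `ẋ = f (t, x, u)`, initial point `ξ`,
input set `U` and final cost `Ψ`. -/
structure ControlProblem (n m : ℕ) where
  T : ℝ
  T_pos : 0 < T
  U : Set (RVec m)
  isCompact_U : IsCompact U
  isConnected_U : IsConnected U
  ξ : RVec n
  f : ℝ → RVec n → RVec m → RVec n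
  Ψ : RVec n → ℝ

namespace ControlProblem

variable {n m : ℕ} (P : ControlProblem n m)

/-- The vector field and the final cost are Lipschitz continuously differentiable. -/
def LipschitzC1 : Prop :=
  Differentiable ℝ P.Ψ ∧
  (∀ t ∈ Set.Icc 0 P.T, ∀ x, ∀ u ∈ P.U,
    DifferentiableAt ℝ (fun y => P.f t y u) x ∧ DifferentiableAt ℝ (fun v => P.f t x v) u) ∧
  ∃ L : ℝ, 0 < L ∧
    (∀ x₁ x₂, |P.Ψ x₁ - P.Ψ x₂| ≤ L * ‖x₁ - x₂‖) ∧
    (∀ x₁ x₂, ‖fderiv ℝ P.Ψ x₁ - fderiv ℝ P.Ψ x₂‖ ≤ L * ‖x₁ - x₂‖) ∧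
    ∀ t₁ ∈ Set.Icc 0 P.T, ∀ t₂ ∈ Set.Icc 0 P.T, ∀ x₁ x₂, ∀ u₁ ∈ P.U, ∀ u₂ ∈ P.U,
      ‖P.f t₁ x₁ u₁ - P.f t₂ x₂ u₂‖ ≤ L * (|t₁ - t₂| + ‖x₁ - x₂‖ + ‖u₁ - u₂‖) ∧
      ‖fderiv ℝ (fun y => P.f t₁ y u₁) x₁ - fderiv ℝ (fun y => P.f t₂ y u₂) x₂‖
        ≤ L * (|t₁ - t₂| + ‖x₁ - x₂‖ + ‖u₁ - u₂‖) ∧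
      ‖fderiv ℝ (fun v => P.f t₁ x₁ v) u₁ - fderiv ℝ (fun v => P.f t₂ x₂ v) u₂‖
        ≤ L * (|t₁ - t₂| + ‖x₁ - x₂‖ + ‖u₁ - u₂‖)

/-- The time interval `[0, T]`, carrying Lebesgue measure. -/
abbrev Time : Type := Set.Icc (0 : ℝ) P.T

instance : MeasureSpace P.Time := Measure.Subtype.measureSpace

instance : IsFiniteMeasure (volume : Measure P.Time) := by
  have : IsFiniteMeasureOnCompacts (volume : Measure P.Time) :=
    IsFiniteMeasureOnCompacts.comap' volume continuous_subtype_val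
      (MeasurableEmbedding.subtype_coe measurableSet_Icc)
  infer_instance

/-- The final time `T`. -/
def finalTime : P.Time := ⟨P.T, P.T_pos.le, le_rfl⟩

/-- A relaxed input: a measurable family `t ↦ μ t` of Borel probability measures on `ℝᵐ` with
`supp (μ t) ⊆ U` for almost every `t`. -/
structure RelaxedInput where
  kernel : Kernel P.Time (RVec m)
  isMarkov : IsMarkovKernel kernel
  support_subset : ∀ᵐ t, (kernel t).support ⊆ P.U

attribute [instance] RelaxedInput.isMarkov

variable {P}

/-- The finite measure `dt ⊗ μ t (du)` on `[0, T] × ℝᵐ`. -/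
def RelaxedInput.toFiniteMeasure (μ : P.RelaxedInput) : FiniteMeasure (P.Time × RVec m) :=
  ⟨(volume : Measure P.Time) ⊗ₘ μ.kernel, inferInstance⟩

/-- The weak topology of relaxed inputs: `μ_N → μ` iff
`∫ ∫ φ (t, u) dμ_{N, t} (u) dt → ∫ ∫ φ (t, u) dμ_t (u) dt` for each bounded continuous `φ`. -/
instance : TopologicalSpace P.RelaxedInput :=
  TopologicalSpace.induced RelaxedInput.toFiniteMeasure inferInstance

variable (P)

/-- Pairs of a state curve and a relaxed input, with uniform convergence of the state curves and
weak convergence of the relaxed inputs. -/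
abbrev Pair : Type := C(P.Time, RVec n) × P.RelaxedInput

/-- `x` is the trajectory of the relaxed input `μ`:
`x 0 = ξ` and `ẋ t = ∫ f (t, x t, u) dμ_t (u)`, in integrated form. -/
def IsTrajectory (x : C(P.Time, RVec n)) (μ : P.RelaxedInput) : Prop :=
  ∀ t, x t = P.ξ + ∫ s in Set.Iic t, ∫ u, P.f s (x s) u ∂(μ.kernel s)

/-- `p` is the costate of the pair: `p T = ∇Ψ (x T)` and
`ṗ t = - (∫ ∂f/∂x (t, x t, u)ᵀ dμ_t (u)) p t`, in integrated form. -/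
def IsCostate (y : P.Pair) (p : C(P.Time, RVec n)) : Prop :=
  ∀ t, p t = gradient P.Ψ (y.1 P.finalTime) + ∫ s in Set.Ici t,
    (∫ u, ContinuousLinearMap.adjoint (fderiv ℝ (fun z => P.f s z u) (y.1 s)) ∂(y.2.kernel s)) (p s)

/-- The costate of a pair. -/
def costate (y : P.Pair) : C(P.Time, RVec n) := Classical.epsilon (P.IsCostate y)

/-- The Hamiltonian `H (t, x, δ, p) = pᵀ ∫ f (t, x, u) dδ (u)`. -/
def hamiltonian (t : P.Time) (x : RVec n) (δ : SignedMeasure (RVec m)) (p : RVec n) : ℝ :=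
  inner ℝ p (signedIntegral δ (P.f t x))

/-- The variations common to all optimality functions: measurable families `δ` of signed measures
with `δ t + μ t ≥ 0` and `∫ dδ t = 0` for almost every `t`. -/
structure IsVariation (μ : P.RelaxedInput) (δ : P.Time → SignedMeasure (RVec m)) : Prop where
  measurable : ∀ B, MeasurableSet B → Measurable fun t => δ t B
  nonneg : ∀ᵐ t, 0 ≤ δ t + (μ.kernel t).toSignedMeasure
  mass_zero : ∀ᵐ t, δ t Set.univ = 0

/-- The optimal value of `∫ H (t, x t, δ t, p t) dt` over the variations `δ` of `μ` that satisfy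
the constraint `C`. -/
def hamiltonianValue (y : P.Pair) (C : (P.Time → SignedMeasure (RVec m)) → Prop) : EReal :=
  ⨅ (δ : P.Time → SignedMeasure (RVec m)) (_ : P.IsVariation y.2 δ ∧ C δ),
    ((∫ t, P.hamiltonian t (y.1 t) (δ t) (P.costate y t) : ℝ) : EReal)

/-- The optimality function `θ_h`: `supp (δ t + μ t) ⊆ U`. -/
def thetaH (y : P.Pair) : EReal :=
  P.hamiltonianValue y fun δ =>
    ∀ᵐ t, signedSupport (δ t + (y.2.kernel t).toSignedMeasure) ⊆ P.U

/-- The discretized optimality function `θ_{N,h}`: `supp (δ t) ⊆ supp (μ t)`. -/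
def thetaNH (y : P.Pair) : EReal :=
  P.hamiltonianValue y fun δ => ∀ᵐ t, signedSupport (δ t) ⊆ (y.2.kernel t).support

/-- The discretized optimality function whose variations are carried by the sample points `v i`:
`supp (δ t) ⊆ {v i}`. It agrees with `thetaNH` where the support of `μ t` consists of all the
sample points. -/
def thetaSample {N : ℕ} (v : Fin N → RVec m) (y : P.Pair) : EReal :=
  P.hamiltonianValue y fun δ => ∀ᵐ t, signedSupport (δ t) ⊆ Set.range v

/-- The relaxed input is empirical on the samples `v`: `μ t = ∑ i, w i t • dirac (v i)` with
measurable weights `w i t ≥ 0` that sum to one. -/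
def IsEmpirical {N : ℕ} (v : Fin N → RVec m) (μ : P.RelaxedInput) : Prop :=
  ∃ w : Fin N → P.Time → ℝ, (∀ i, Measurable (w i)) ∧ (∀ i t, 0 ≤ w i t) ∧
    (∀ t, ∑ i, w i t = 1) ∧
    ∀ᵐ t, μ.kernel t = ∑ i, ENNReal.ofReal (w i t) • Measure.dirac (v i)

/-- The feasible set of the relaxed problem: the pairs `(x^(μ), μ)`. -/
def relaxedPairs : Set P.Pair := {y | P.IsTrajectory y.1 y.2}

/-- The feasible set of the sampled problem: the pairs `(x^(μ), μ)` with `μ` empirical. -/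
def empiricalPairs {N : ℕ} (v : Fin N → RVec m) : Set P.Pair :=
  {y | P.IsTrajectory y.1 y.2 ∧ P.IsEmpirical v y.2}

/-- The cost `Ψ (x T)`. -/
def cost (y : P.Pair) : EReal := (P.Ψ (y.1 P.finalTime) : EReal)

end ControlProblem

end

/-!
Trajectory and costate solve Volterra equations with uniformly Lipschitz fields, and for such fields
weak convergence of the inputs becomes uniform in time by equicontinuity; hence both depend
continuously on the relaxed input. A variation of `μ` is a difference `μ' - μ` of relaxed inputs, so
each optimality function is an infimum, over a set of `μ'`, of the first variation of the cost. The
first variation is affine and weakly continuous in `μ'` and depends on the pair uniformly in `μ'`,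
which makes `θ_h` lower semicontinuous. It is the derivative of the cost along the segment from `μ`
to `μ'`, hence nonnegative at a minimizer.

By Borel–Cantelli the samples are almost surely asymptotically dense in `U`, and moving the mass of
`μ` to nearest samples gives empirical inputs that converge weakly to `μ`. Mixing in a little of
every point mass makes all weights positive, which reduces the recovery sequences for `θ_{N,h}` to
those for its sample version.
-/

noncomputable section

/-! ### Integral equations of Volterra type -/

section Volterra

/-- A continuously varying family of sets `I t` along which integral equations
`z t = c + ∫ s in I t, a s (z s)` are well posed: for each rate `K` there is a weight growing at
least at that rate along the family. -/
structure IsVolterra {X : Type*} [TopologicalSpace X] [MeasurableSpace X] (vol : Measure X)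
    (I : X → Set X) : Prop where
  measurableSet : ∀ t, MeasurableSet (I t)
  tendsto_symmDiff : ∀ t₀, Tendsto (fun t => vol.real (symmDiff (I t) (I t₀))) (𝓝 t₀) (𝓝 0)
  exists_weight : ∀ K : ℝ, 0 < K → ∃ e : C(X, ℝ), (∀ t, 0 < e t) ∧
    ∀ t, ∫ s in I t, e s ∂vol ≤ e t / K

/-- A time-dependent vector field that is bounded at the origin and Lipschitz in the state, and that
is measurable along each continuous curve. -/
structure IsLipschitzField {X : Type*} [TopologicalSpace X] [MeasurableSpace X]
    {E : Type*} [NormedAddCommGroup E] (vol : Measure X) (a : X → E → E) (L : ℝ) : Prop where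
  aestronglyMeasurable : ∀ z : C(X, E), AEStronglyMeasurable (fun s => a s (z s)) vol
  norm_sub_le : ∀ᵐ s ∂vol, ∀ z z', ‖a s z - a s z'‖ ≤ L * ‖z - z'‖
  bounded : ∃ B, ∀ᵐ s ∂vol, ‖a s 0‖ ≤ B

/-- The integral equation `z t = c + ∫ s in I t, a s (z s)`. -/
def IsVolterraSolution {X : Type*} [TopologicalSpace X] [MeasurableSpace X]
    {E : Type*} [NormedAddCommGroup E] [NormedSpace ℝ E] (vol : Measure X) (I : X → Set X) (c : E)
    (a : X → E → E) (z : C(X, E)) : Prop :=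
  ∀ t, z t = c + ∫ s in I t, a s (z s) ∂vol

theorem norm_setIntegral_sub_setIntegral_le {X : Type*} [MeasurableSpace X] {E : Type*}
    [NormedAddCommGroup E] [NormedSpace ℝ E] {vol : Measure X} [IsFiniteMeasure vol] {A B : Set X}
    (hA : MeasurableSet A) (hB : MeasurableSet B) {g : X → E} {C : ℝ} (hg : Integrable g vol)
    (hC : ∀ᵐ s ∂vol, ‖g s‖ ≤ C) :
    ‖(∫ s in A, g s ∂vol) - ∫ s in B, g s ∂vol‖ ≤ C * vol.real (symmDiff A B) := by
  rw [← integral_indicator hA, ← integral_indicator hB,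
    ← integral_sub (hg.indicator hA) (hg.indicator hB)]
  have hAB : MeasurableSet (symmDiff A B) := hA.symmDiff hB
  calc _ ≤ ∫ s, (symmDiff A B).indicator (fun _ => C) s ∂vol := by
        refine norm_integral_le_of_norm_le ((integrable_const C).indicator hAB) ?_
        filter_upwards [hC] with s hs
        by_cases hsA : s ∈ A <;> by_cases hsB : s ∈ B <;>
          simp [Set.indicator, Set.mem_symmDiff, hsA, hsB, hs]
    _ = C * vol.real (symmDiff A B) := by
        rw [integral_indicator hAB, setIntegral_const, smul_eq_mul, mul_comm]

variable {X : Type*} [TopologicalSpace X] [MeasurableSpace X] {vol : Measure X} {I : X → Set X}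
  {E : Type*} [NormedAddCommGroup E] {L : ℝ}

theorem IsLipschitzField.exists_norm_le [CompactSpace X] {a : X → E → E}
    (ha : IsLipschitzField vol a L) (hL : 0 ≤ L) (z : C(X, E)) :
    ∃ B, ∀ᵐ s ∂vol, ‖a s (z s)‖ ≤ B := by
  obtain ⟨B, hB⟩ := ha.bounded
  refine ⟨B + L * ‖z‖, ?_⟩
  filter_upwards [ha.norm_sub_le, hB] with s hlip hs
  calc ‖a s (z s)‖ ≤ ‖a s 0‖ + ‖a s (z s) - a s 0‖ := norm_le_norm_add_norm_sub' _ _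
    _ ≤ B + L * ‖z s - 0‖ := add_le_add hs (hlip _ _)
    _ ≤ B + L * ‖z‖ := by
      rw [sub_zero]
      gcongr
      exact z.norm_coe_le_norm s

variable [IsFiniteMeasure vol]

theorem IsVolterra.continuous_setIntegral [NormedSpace ℝ E] (hI : IsVolterra vol I) {g : X → E}
    {C : ℝ} (hg : Integrable g vol) (hC : ∀ᵐ s ∂vol, ‖g s‖ ≤ C) :
    Continuous fun t => ∫ s in I t, g s ∂vol := by
  refine continuous_iff_continuousAt.2 fun t₀ => tendsto_iff_norm_sub_tendsto_zero.2 ?_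
  refine squeeze_zero (fun _ => norm_nonneg _) (fun t => norm_setIntegral_sub_setIntegral_le
    (hI.measurableSet t) (hI.measurableSet t₀) hg hC) ?_
  simpa using (hI.tendsto_symmDiff t₀).const_mul C

variable [CompactSpace X]

theorem IsLipschitzField.integrable {a : X → E → E} (ha : IsLipschitzField vol a L) (hL : 0 ≤ L)
    (z : C(X, E)) : Integrable (fun s => a s (z s)) vol :=
  let ⟨B, hB⟩ := ha.exists_norm_le hL z
  (integrable_const B).mono' (ha.aestronglyMeasurable z) hB

variable [OpensMeasurableSpace X]

theorem norm_setIntegral_sub_setIntegral_le_of_isLipschitzField [NormedSpace ℝ E]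
    {a : X → E → E} (ha : IsLipschitzField vol a L) (hL : 0 ≤ L) (z z' : C(X, E)) (A : Set X) :
    ‖(∫ s in A, a s (z s) ∂vol) - ∫ s in A, a s (z' s) ∂vol‖
      ≤ L * ∫ s in A, ‖(z - z') s‖ ∂vol := by
  rw [← integral_sub (ha.integrable hL z).integrableOn (ha.integrable hL z').integrableOn,
    ← integral_const_mul]
  have hint : Integrable (fun s => L * ‖(z - z') s‖) vol :=
    Continuous.integrable_of_hasCompactSupport (by fun_prop) (.of_compactSpace _)
  refine norm_integral_le_of_norm_le hint.integrableOn ?_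
  filter_upwards [ae_restrict_of_ae ha.norm_sub_le] with s hs using hs _ _

theorem setIntegral_norm_le_of_norm_le_weight {e : C(X, ℝ)} {K M : ℝ} {A : Set X} {t : X}
    (he : ∫ s in A, e s ∂vol ≤ e t / K) (hM : 0 ≤ M) {w : C(X, E)}
    (hw : ∀ s, ‖w s‖ ≤ M * e s) : ∫ s in A, ‖w s‖ ∂vol ≤ M * (e t / K) :=
  calc ∫ s in A, ‖w s‖ ∂vol ≤ ∫ s in A, M * e s ∂vol :=
        have hint {g : X → ℝ} (hg : Continuous g) : IntegrableOn g A vol :=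
          (hg.integrable_of_hasCompactSupport (.of_compactSpace _)).integrableOn
        integral_mono (hint (by fun_prop)) (hint (by fun_prop)) hw
    _ = M * ∫ s in A, e s ∂vol := integral_const_mul _ _
    _ ≤ M * (e t / K) := mul_le_mul_of_nonneg_left he hM

theorem IsVolterra.gronwall [Nonempty X] [NormedSpace ℝ E] (hI : IsVolterra vol I) (hL : 0 < L) :
    ∃ C : ℝ, 0 ≤ C ∧ ∀ (w : C(X, E)) (ε : ℝ), 0 ≤ ε →
      (∀ t, ‖w t‖ ≤ ε + L * ∫ s in I t, ‖w s‖ ∂vol) → ‖w‖ ≤ C * ε := by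
  obtain ⟨e, he, heI⟩ := hI.exists_weight (2 * L) (by positivity)
  let e' : C(X, ℝ) := ⟨fun t => (e t)⁻¹, e.continuous.inv₀ fun t => (he t).ne'⟩
  refine ⟨2 * ‖e'‖ * ‖e‖, by positivity, fun w ε hε hw => ?_⟩
  have hw_norm (t : X) : ‖w t‖ = e t * ‖(e' • w) t‖ := by
    simp [e', norm_smul, abs_of_pos (he t), mul_inv_cancel_left₀ (he t).ne']
  have hw_le (t : X) : ‖w t‖ ≤ ‖e' • w‖ * e t := by
    rw [hw_norm, mul_comm]
    exact mul_le_mul_of_nonneg_right ((e' • w).norm_coe_le_norm t) (he t).le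
  have hhalf : ‖e' • w‖ ≤ ‖e'‖ * ε + ‖e' • w‖ / 2 := by
    refine (ContinuousMap.norm_le_of_nonempty _).2 fun t => ?_
    have hweight := setIntegral_norm_le_of_norm_le_weight (heI t) (norm_nonneg _) hw_le
    have hε_le : ε ≤ e t * (‖e'‖ * ε) := by
      have hone : 1 ≤ e t * ‖e'‖ :=
        (inv_le_iff_one_le_mul₀' (he t)).1 ((le_abs_self _).trans (e'.norm_coe_le_norm t))
      nlinarith
    refine le_of_mul_le_mul_left ?_ (he t)
    calc e t * ‖(e' • w) t‖ = ‖w t‖ := (hw_norm t).symm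
      _ ≤ ε + L * (‖e' • w‖ * (e t / (2 * L))) := (hw t).trans (by gcongr)
      _ = ε + e t * (‖e' • w‖ / 2) := by field_simp
      _ ≤ e t * (‖e'‖ * ε + ‖e' • w‖ / 2) := by linarith
  refine (ContinuousMap.norm_le_of_nonempty _).2 fun t => (hw_le t).trans ?_
  calc ‖e' • w‖ * e t ≤ (2 * ‖e'‖ * ε) * ‖e‖ :=
        mul_le_mul (by linarith) ((le_abs_self _).trans (e.norm_coe_le_norm t)) (he t).le
          (by positivity)
    _ = 2 * ‖e'‖ * ‖e‖ * ε := by ring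

theorem IsVolterra.exists_norm_sub_le_of_defect [Nonempty X] [NormedSpace ℝ E]
    (hI : IsVolterra vol I) (hL : 0 < L) :
    ∃ C : ℝ, 0 ≤ C ∧ ∀ {a : X → E → E} {c : E} {z z₀ : C(X, E)} {ε : ℝ},
      IsLipschitzField vol a L → IsVolterraSolution vol I c a z →
      (∀ t, ‖z₀ t - (c + ∫ s in I t, a s (z₀ s) ∂vol)‖ ≤ ε) → ‖z₀ - z‖ ≤ C * ε := by
  obtain ⟨C, hC0, hC⟩ := hI.gronwall (E := E) hL
  refine ⟨C, hC0, fun {a c z z₀ ε} ha hz hdefect => ?_⟩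
  have hε : 0 ≤ ε := (norm_nonneg _).trans (hdefect (Classical.arbitrary X))
  refine hC _ _ hε fun t => ?_
  calc ‖(z₀ - z) t‖ = ‖(z₀ t - (c + ∫ s in I t, a s (z₀ s) ∂vol))
        + ((∫ s in I t, a s (z₀ s) ∂vol) - ∫ s in I t, a s (z s) ∂vol)‖ := by
        rw [ContinuousMap.sub_apply, hz t]
        congr 1
        abel
    _ ≤ ε + L * ∫ s in I t, ‖(z₀ - z) s‖ ∂vol := (norm_add_le _ _).trans <|
        add_le_add (hdefect t)
          (norm_setIntegral_sub_setIntegral_le_of_isLipschitzField ha hL.le _ _ _)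

theorem IsVolterraSolution.tendsto_of_tendstoUniformly [Nonempty X] [NormedSpace ℝ E]
    (hI : IsVolterra vol I) (hL : 0 < L) {ι : Type*} {l : Filter ι} {a : ι → X → E → E} {c : ι → E}
    (ha : ∀ j, IsLipschitzField vol (a j) L) {z : ι → C(X, E)} {z₀ : C(X, E)}
    (hz : ∀ j, IsVolterraSolution vol I (c j) (a j) (z j))
    (hz₀ : TendstoUniformly (fun j t => c j + ∫ s in I t, a j s (z₀ s) ∂vol) z₀ l) :
    Tendsto z l (𝓝 z₀) := by
  obtain ⟨C, hC0, hC⟩ := hI.exists_norm_sub_le_of_defect (E := E) hL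
  refine Metric.tendsto_nhds.2 fun ε hε => ?_
  filter_upwards [Metric.tendstoUniformly_iff.1 hz₀ (ε / (C + 1)) (by positivity)] with j hj
  rw [dist_comm, dist_eq_norm]
  calc ‖z₀ - z j‖ ≤ C * (ε / (C + 1)) :=
        hC (ha j) (hz j) fun t => by simpa [dist_eq_norm] using (hj t).le
    _ < ε := by
      rw [mul_div_assoc', div_lt_iff₀ (by positivity)]
      linarith

theorem IsVolterraSolution.eq [Nonempty X] [NormedSpace ℝ E] (hI : IsVolterra vol I) (hL : 0 < L)
    {a : X → E → E} {c : E} (ha : IsLipschitzField vol a L) {z z' : C(X, E)}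
    (hz : IsVolterraSolution vol I c a z) (hz' : IsVolterraSolution vol I c a z') : z = z' := by
  obtain ⟨C, -, hC⟩ := hI.exists_norm_sub_le_of_defect (E := E) hL
  have h := hC (ε := 0) ha hz' fun t => by rw [← hz t, sub_self, norm_zero]
  rw [mul_zero] at h
  exact sub_eq_zero.1 (norm_le_zero_iff.1 h)

/-- Picard iteration contracts in the norm weighted by `e⁻¹`. -/
theorem IsVolterra.exists_isVolterraSolution [NormedSpace ℝ E] [CompleteSpace E]
    (hI : IsVolterra vol I) (hL : 0 < L) (c : E) {a : X → E → E} (ha : IsLipschitzField vol a L) :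
    ∃ z : C(X, E), IsVolterraSolution vol I c a z := by
  obtain ⟨e, he, heI⟩ := hI.exists_weight (2 * L) (by positivity)
  have hcont (z : C(X, E)) : Continuous fun t => c + ∫ s in I t, a s (z s) ∂vol :=
    let ⟨_, hB⟩ := ha.exists_norm_le hL.le z
    continuous_const.add (hI.continuous_setIntegral (ha.integrable hL.le z) hB)
  let Φ : C(X, E) → C(X, E) := fun w =>
    ⟨fun t => (e t)⁻¹ • (c + ∫ s in I t, a s ((e • w) s) ∂vol),
      (e.continuous.inv₀ fun t => (he t).ne').smul (hcont (e • w))⟩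
  have hΦ : ContractingWith (1 / 2) Φ := by
    refine ⟨by rw [← NNReal.coe_lt_coe]; norm_num, LipschitzWith.of_dist_le_mul fun w w' => ?_⟩
    rw [dist_eq_norm, dist_eq_norm]
    refine (ContinuousMap.norm_le _ (by positivity)).2 fun t => ?_
    have hdiff (s : X) : ‖(e • w - e • w') s‖ ≤ ‖w - w'‖ * e s := by
      rw [← smul_sub, ContinuousMap.smul_apply', norm_smul, Real.norm_of_nonneg (he s).le, mul_comm]
      exact mul_le_mul_of_nonneg_right ((w - w').norm_coe_le_norm s) (he s).le
    calc ‖(Φ w - Φ w') t‖ = (e t)⁻¹ * ‖(∫ s in I t, a s ((e • w) s) ∂vol)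
          - ∫ s in I t, a s ((e • w') s) ∂vol‖ := by
          simp only [Φ, ContinuousMap.sub_apply, ContinuousMap.coe_mk, ← smul_sub,
            add_sub_add_left_eq_sub, norm_smul, norm_inv, Real.norm_of_nonneg (he t).le]
      _ ≤ (e t)⁻¹ * (L * (‖w - w'‖ * (e t / (2 * L)))) := by
          have := (he t).le
          gcongr
          refine (norm_setIntegral_sub_setIntegral_le_of_isLipschitzField ha hL.le _ _ _).trans ?_
          gcongr
          exact setIntegral_norm_le_of_norm_le_weight (heI t) (norm_nonneg _) hdiff
      _ = ((1 / 2 : NNReal) : ℝ) * ‖w - w'‖ := by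
          have := (he t).ne'
          push_cast
          field_simp
  obtain ⟨w, hw⟩ : ∃ w, Φ w = w := ⟨_, hΦ.fixedPoint_isFixedPt⟩
  refine ⟨e • w, fun t => ?_⟩
  have hwt : (e t)⁻¹ • (c + ∫ s in I t, a s ((e • w) s) ∂vol) = w t := congrArg (· t) hw
  rw [ContinuousMap.smul_apply', ← hwt, smul_inv_smul₀ (he t).ne']

theorem IsVolterra.existsUnique [Nonempty X] [NormedSpace ℝ E] [CompleteSpace E]
    (hI : IsVolterra vol I) (hL : 0 < L) (c : E) {a : X → E → E} (ha : IsLipschitzField vol a L) :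
    ∃! z : C(X, E), IsVolterraSolution vol I c a z :=
  let ⟨z, hz⟩ := hI.exists_isVolterraSolution hL c ha
  ⟨z, hz, fun _ hz' => hz'.eq hI hL ha hz⟩

end Volterra

/-! ### Integral estimates and Taylor remainders -/

theorem integrable_of_continuousOn_of_ae_mem {X : Type*} [TopologicalSpace X] [T2Space X]
    [MeasurableSpace X] [OpensMeasurableSpace X] {κ : Measure X} [IsFiniteMeasureOnCompacts κ]
    {E : Type*} [NormedAddCommGroup E] {K : Set X} (hK : IsCompact K) (hκ : ∀ᵐ u ∂κ, u ∈ K)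
    {g : X → E} (hg : ContinuousOn g K) : Integrable g κ := by
  rw [← Measure.restrict_eq_self_of_ae_mem hκ]
  exact hg.integrableOn_compact hK

theorem norm_integral_sub_integral_le {X : Type*} [MeasurableSpace X] {κ : Measure X}
    [IsProbabilityMeasure κ] {E : Type*} [NormedAddCommGroup E] [NormedSpace ℝ E] {g g' : X → E}
    (hg : Integrable g κ) (hg' : Integrable g' κ) {B : ℝ} (hB : ∀ᵐ u ∂κ, ‖g u - g' u‖ ≤ B) :
    ‖(∫ u, g u ∂κ) - ∫ u, g' u ∂κ‖ ≤ B := by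
  rw [← integral_sub hg hg']
  simpa using norm_integral_le_of_norm_le_const hB

theorem norm_setIntegral_le_mul_measureReal_univ {X : Type*} [MeasurableSpace X] {κ : Measure X}
    [IsFiniteMeasure κ] {E : Type*} [NormedAddCommGroup E] [NormedSpace ℝ E] {g : X → E} {B : ℝ}
    (hB0 : 0 ≤ B) (hB : ∀ᵐ u ∂κ, ‖g u‖ ≤ B) (S : Set X) :
    ‖∫ u in S, g u ∂κ‖ ≤ B * κ.real Set.univ :=
  calc ‖∫ u in S, g u ∂κ‖ ≤ B * (κ.restrict S).real Set.univ :=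
        norm_integral_le_of_norm_le_const (ae_restrict_of_ae hB)
    _ ≤ B * κ.real Set.univ := by
      rw [measureReal_restrict_apply_univ]
      exact mul_le_mul_of_nonneg_left (measureReal_mono (Set.subset_univ S)) hB0

theorem norm_sub_sub_fderiv_le {E F : Type*} [NormedAddCommGroup E] [NormedSpace ℝ E]
    [NormedAddCommGroup F] [NormedSpace ℝ F] {g : E → F} (hg : Differentiable ℝ g) {L : ℝ}
    (hL : 0 ≤ L) (hlip : ∀ x y, ‖fderiv ℝ g x - fderiv ℝ g y‖ ≤ L * ‖x - y‖) (x y : E) :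
    ‖g y - g x - fderiv ℝ g x (y - x)‖ ≤ L * ‖y - x‖ ^ 2 := by
  have h := (convex_closedBall x ‖y - x‖).norm_image_sub_le_of_norm_fderiv_le' (𝕜 := ℝ)
    (f := g) (φ := fderiv ℝ g x) (C := L * ‖y - x‖) (x := x) (y := y) (fun z _ => hg z)
    (fun z hz => (hlip z x).trans (mul_le_mul_of_nonneg_left (mem_closedBall_iff_norm.1 hz) hL))
    (by simp) (by simp [dist_eq_norm])
  rwa [pow_two, ← mul_assoc]

namespace ControlProblem

variable {n m : ℕ} (P : ControlProblem n m)

/-! ### Time -/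

instance : Nonempty P.Time := ⟨P.finalTime⟩

theorem volume_preimage_time_le (S : Set ℝ) :
    (volume : Measure P.Time) (Subtype.val ⁻¹' S) ≤ volume S := by
  have h : (volume : Measure P.Time) (Subtype.val ⁻¹' S)
      = volume (Subtype.val '' (Subtype.val ⁻¹' S : Set P.Time)) :=
    (MeasurableEmbedding.subtype_coe measurableSet_Icc).comap_apply _ _
  rw [h]
  exact measure_mono (Set.image_preimage_subset _ _)

theorem setIntegral_time_le {S : Set P.Time} (hS : MeasurableSet S) {R : Set ℝ}
    (hSR : ∀ s ∈ S, (s : ℝ) ∈ R) {g : ℝ → ℝ} (hg : IntegrableOn g R) (hg0 : ∀ s, 0 ≤ g s) :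
    ∫ s in S, g s ≤ ∫ s in R, g s := by
  have hemb : MeasurableEmbedding (Subtype.val : P.Time → ℝ) :=
    MeasurableEmbedding.subtype_coe measurableSet_Icc
  have hrestrict : ∫ s in S, g s = ∫ s in Set.Icc 0 P.T, (Subtype.val '' S).indicator g s := by
    rw [← integral_indicator hS, ← integral_subtype_comap measurableSet_Icc]
    refine integral_congr_ae (.of_forall fun s => ?_)
    have : (s : ℝ) ∈ Subtype.val '' S ↔ s ∈ S := Subtype.val_injective.mem_set_image
    by_cases hs : s ∈ S <;> simp only [Set.indicator, this, hs, if_true, if_false]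
  rw [hrestrict, setIntegral_indicator (hemb.measurableSet_image.2 hS)]
  refine setIntegral_mono_set hg (.of_forall hg0) (LE.le.eventuallyLE ?_)
  rintro _ ⟨-, s, hs, rfl⟩
  exact hSR s hs

theorem tendsto_symmDiff_time {I : P.Time → Set P.Time}
    (hI : ∀ t t₀, symmDiff (I t) (I t₀) ⊆ Subtype.val ⁻¹' Set.uIcc (t : ℝ) t₀) (t₀ : P.Time) :
    Tendsto (fun t => volume.real (symmDiff (I t) (I t₀))) (𝓝 t₀) (𝓝 0) := by
  have h : ∀ t : P.Time, volume.real (symmDiff (I t) (I t₀)) ≤ |(t₀ : ℝ) - t| := fun t => by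
    refine ENNReal.toReal_le_of_le_ofReal (abs_nonneg _) ?_
    refine (measure_mono (hI t t₀)).trans ((P.volume_preimage_time_le _).trans ?_)
    rw [Set.uIcc, Real.volume_Icc, max_sub_min_eq_abs]
  refine squeeze_zero (fun _ => measureReal_nonneg) h ?_
  have : Continuous fun t : P.Time => |(t₀ : ℝ) - t| := by fun_prop
  simpa using this.tendsto t₀

theorem isVolterra_Iic : IsVolterra (volume : Measure P.Time) Set.Iic where
  measurableSet _ := measurableSet_Iic
  tendsto_symmDiff := P.tendsto_symmDiff_time fun t t₀ s hs => by
    simp only [Set.mem_symmDiff, Set.mem_Iic, not_le, Set.mem_preimage, Set.mem_uIcc,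
      Subtype.coe_le_coe] at hs ⊢
    grind
  exists_weight K hK := by
    refine ⟨⟨fun t => Real.exp (K * t), by fun_prop⟩, fun t => Real.exp_pos _, fun t => ?_⟩
    have h := integrableOn_exp_mul_Iic hK (t : ℝ)
    refine (P.setIntegral_time_le measurableSet_Iic (R := Set.Iic (t : ℝ)) (fun s hs => hs)
      h fun s => (Real.exp_pos _).le).trans ?_
    rw [integral_exp_mul_Iic hK]
    rfl

theorem isVolterra_Ici : IsVolterra (volume : Measure P.Time) Set.Ici where
  measurableSet _ := measurableSet_Ici
  tendsto_symmDiff := P.tendsto_symmDiff_time fun t t₀ s hs => by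
    simp only [Set.mem_symmDiff, Set.mem_Ici, not_le, Set.mem_preimage, Set.mem_uIcc,
      Subtype.coe_le_coe] at hs ⊢
    grind
  exists_weight K hK := by
    refine ⟨⟨fun t => Real.exp (-K * t), by fun_prop⟩, fun t => Real.exp_pos _, fun t => ?_⟩
    have h := integrableOn_exp_mul_Ioi (neg_lt_zero.2 hK) (t : ℝ)
    refine (P.setIntegral_time_le measurableSet_Ici (R := Set.Ici (t : ℝ)) (fun s hs => hs)
      ((integrableOn_Ici_iff_integrableOn_Ioi (by finiteness)).2 h)
      fun s => (Real.exp_pos _).le).trans ?_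
    rw [integral_Ici_eq_integral_Ioi, integral_exp_mul_Ioi (neg_lt_zero.2 hK), neg_div_neg_eq]
    rfl

variable {P}

/-! ### Averages over relaxed inputs -/

variable (P) in
/-- The compact set `[0, T] × U` on which integrands are continuous. -/
def timeInput : Set (P.Time × RVec m) := Set.univ ×ˢ P.U

variable (P) in
theorem isCompact_timeInput : IsCompact P.timeInput := isCompact_univ.prod P.isCompact_U

theorem mem_timeInput {t : P.Time} {u : RVec m} (hu : u ∈ P.U) : (t, u) ∈ P.timeInput :=
  ⟨Set.mem_univ t, hu⟩

theorem continuousOn_slice {E : Type*} [TopologicalSpace E] {φ : P.Time × RVec m → E}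
    (hφ : ContinuousOn φ P.timeInput) (t : P.Time) : ContinuousOn (fun u => φ (t, u)) P.U :=
  hφ.comp (by fun_prop) fun _ => mem_timeInput

namespace RelaxedInput

variable (μ : P.RelaxedInput) {E : Type*} [NormedAddCommGroup E]

theorem ae_mem : ∀ᵐ t, ∀ᵐ u ∂μ.kernel t, u ∈ P.U := by
  filter_upwards [μ.support_subset] with t ht
  exact mem_of_superset Measure.support_mem_ae ht

theorem ae_mem_timeInput : ∀ᵐ q ∂(volume : Measure P.Time) ⊗ₘ μ.kernel, q ∈ P.timeInput :=
  Measure.ae_compProd_of_ae_ae P.isCompact_timeInput.measurableSet <| by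
    filter_upwards [μ.ae_mem] with t ht
    filter_upwards [ht] with u hu using mem_timeInput hu

theorem integrable_compProd {φ : P.Time × RVec m → E} (hφ : ContinuousOn φ P.timeInput) :
    Integrable φ ((volume : Measure P.Time) ⊗ₘ μ.kernel) :=
  integrable_of_continuousOn_of_ae_mem P.isCompact_timeInput μ.ae_mem_timeInput hφ

theorem ae_integrable {φ : P.Time × RVec m → E} (hφ : ContinuousOn φ P.timeInput) :
    ∀ᵐ t, Integrable (fun u => φ (t, u)) (μ.kernel t) := by
  filter_upwards [μ.ae_mem] with t ht
  exact integrable_of_continuousOn_of_ae_mem P.isCompact_U ht (continuousOn_slice hφ t)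

variable [NormedSpace ℝ E]

/-- The average `∫ φ (t, u) dμ_t (u)`. -/
def avg (φ : P.Time × RVec m → E) (t : P.Time) : E :=
  ∫ u, φ (t, u) ∂μ.kernel t

theorem integrable_avg {φ : P.Time × RVec m → E} (hφ : ContinuousOn φ P.timeInput) :
    Integrable (μ.avg φ) :=
  (μ.integrable_compProd hφ).integral_compProd

theorem integral_avg {φ : P.Time × RVec m → E} (hφ : ContinuousOn φ P.timeInput) :
    ∫ t, μ.avg φ t = ∫ q, φ q ∂(volume : Measure P.Time) ⊗ₘ μ.kernel :=
  (Measure.integral_compProd (μ.integrable_compProd hφ)).symm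

theorem ae_norm_avg_le {φ : P.Time × RVec m → E} {B : ℝ} (hB : ∀ q ∈ P.timeInput, ‖φ q‖ ≤ B) :
    ∀ᵐ t, ‖μ.avg φ t‖ ≤ B := by
  filter_upwards [μ.ae_mem] with t ht
  have h : ∀ᵐ u ∂μ.kernel t, ‖φ (t, u)‖ ≤ B := by
    filter_upwards [ht] with u hu using hB _ (mem_timeInput hu)
  simpa [avg] using norm_integral_le_of_norm_le_const h

theorem ae_norm_avg_sub_avg_le {φ ψ : P.Time × RVec m → E} (hφ : ContinuousOn φ P.timeInput)
    (hψ : ContinuousOn ψ P.timeInput) {B : ℝ} (hB : ∀ q ∈ P.timeInput, ‖φ q - ψ q‖ ≤ B) :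
    ∀ᵐ t, ‖μ.avg φ t - μ.avg ψ t‖ ≤ B := by
  filter_upwards [μ.ae_mem, μ.ae_integrable hφ, μ.ae_integrable hψ] with t ht hφt hψt
  refine norm_integral_sub_integral_le hφt hψt ?_
  filter_upwards [ht] with u hu using hB _ (mem_timeInput hu)

theorem ae_clm_avg [CompleteSpace E] {F : Type*} [NormedAddCommGroup F] [NormedSpace ℝ F]
    [CompleteSpace F] (A : P.Time → E →L[ℝ] F) {φ : P.Time × RVec m → E}
    (hφ : ContinuousOn φ P.timeInput) :
    ∀ᵐ t, A t (μ.avg φ t) = μ.avg (fun q => A q.1 (φ q)) t := by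
  filter_upwards [μ.ae_integrable hφ] with t ht using ((A t).integral_comp_comm ht).symm

theorem ae_inner_avg {F : Type*} [NormedAddCommGroup F] [InnerProductSpace ℝ F] [CompleteSpace F]
    (p : P.Time → F) {φ : P.Time × RVec m → F} (hφ : ContinuousOn φ P.timeInput) :
    ∀ᵐ t, inner ℝ (p t) (μ.avg φ t) = μ.avg (fun q => inner ℝ (p q.1) (φ q)) t :=
  μ.ae_clm_avg (fun t => innerSL ℝ (p t)) hφ

end RelaxedInput

/-! ### Regularity of the data -/

variable (P) in
/-- The weakening of `LipschitzC1` in which the vector field and its state derivative are Lipschitz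
in the state only, uniformly in `(t, u) ∈ [0, T] × U`, and jointly continuous. -/
structure LipschitzC1InState (L : ℝ) : Prop where
  pos : 0 < L
  differentiable_cost : Differentiable ℝ P.Ψ
  lipschitz_fderiv_cost : ∀ x x', ‖fderiv ℝ P.Ψ x - fderiv ℝ P.Ψ x'‖ ≤ L * ‖x - x'‖
  differentiable_field : ∀ t : P.Time, ∀ u ∈ P.U, Differentiable ℝ fun x => P.f t x u
  continuousOn_field :
    ContinuousOn (fun q : (P.Time × RVec m) × RVec n => P.f q.1.1 q.2 q.1.2)
      (P.timeInput ×ˢ Set.univ)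
  continuousOn_fderiv_field :
    ContinuousOn (fun q : (P.Time × RVec m) × RVec n => fderiv ℝ (fun z => P.f q.1.1 z q.1.2) q.2)
      (P.timeInput ×ˢ Set.univ)
  lipschitz_field : ∀ t : P.Time, ∀ x x', ∀ u ∈ P.U, ‖P.f t x u - P.f t x' u‖ ≤ L * ‖x - x'‖
  lipschitz_fderiv_field : ∀ t : P.Time, ∀ x x', ∀ u ∈ P.U,
    ‖fderiv ℝ (fun z => P.f t z u) x - fderiv ℝ (fun z => P.f t z u) x'‖ ≤ L * ‖x - x'‖

theorem continuousOn_of_norm_sub_le {E : Type*} [NormedAddCommGroup E]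
    {g : P.Time → RVec n → RVec m → E} {L : ℝ} (hL : 0 ≤ L)
    (hg : ∀ (t₁ t₂ : P.Time) x₁ x₂, ∀ u₁ ∈ P.U, ∀ u₂ ∈ P.U, ‖g t₁ x₁ u₁ - g t₂ x₂ u₂‖
      ≤ L * (|(t₁ : ℝ) - t₂| + ‖x₁ - x₂‖ + ‖u₁ - u₂‖)) :
    ContinuousOn (fun q : (P.Time × RVec m) × RVec n => g q.1.1 q.2 q.1.2)
      (P.timeInput ×ˢ Set.univ) := by
  have h : LipschitzOnWith (L * 3).toNNReal
      (fun q : (P.Time × RVec m) × RVec n => g q.1.1 q.2 q.1.2) (P.timeInput ×ˢ Set.univ) := by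
    refine LipschitzOnWith.of_dist_le_mul ?_
    rintro q ⟨⟨-, hq⟩, -⟩ r ⟨⟨-, hr⟩, -⟩
    have ht : |(q.1.1 : ℝ) - r.1.1| ≤ dist q r := (le_max_left _ _).trans (le_max_left _ _)
    have hu : ‖q.1.2 - r.1.2‖ ≤ dist q r :=
      (dist_eq_norm q.1.2 r.1.2).symm.le.trans ((le_max_right _ _).trans (le_max_left _ _))
    have hx : ‖q.2 - r.2‖ ≤ dist q r := (dist_eq_norm q.2 r.2).symm.le.trans (le_max_right _ _)
    rw [Real.coe_toNNReal _ (by positivity), dist_eq_norm, mul_assoc]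
    exact (hg _ _ _ _ _ hq _ hr).trans (mul_le_mul_of_nonneg_left (by linarith) hL)
  exact h.continuousOn

theorem LipschitzC1.exists_lipschitzC1InState (hP : P.LipschitzC1) :
    ∃ L, P.LipschitzC1InState L := by
  obtain ⟨hΨ, hf, L, hL, -, hΨL, h⟩ := hP
  refine ⟨L, ⟨hL, hΨ, hΨL, fun t u hu x => (hf t t.2 x u hu).1,
    continuousOn_of_norm_sub_le (g := fun t => P.f t) hL.le
      fun t₁ t₂ x₁ x₂ u₁ h₁ u₂ h₂ => (h t₁ t₁.2 t₂ t₂.2 x₁ x₂ u₁ h₁ u₂ h₂).1,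
    continuousOn_of_norm_sub_le (g := fun t x u => fderiv ℝ (fun z => P.f t z u) x) hL.le
      fun t₁ t₂ x₁ x₂ u₁ h₁ u₂ h₂ => (h t₁ t₁.2 t₂ t₂.2 x₁ x₂ u₁ h₁ u₂ h₂).2.1,
    fun t x x' u hu => ?_, fun t x x' u hu => ?_⟩⟩
  · simpa using (h t t.2 t t.2 x x' u hu u hu).1
  · simpa using (h t t.2 t t.2 x x' u hu u hu).2.1

variable (P) in
/-- The velocity `f (t, x t, u)` along the curve `x`, as a function of `(t, u)`. -/
def velocity (x : C(P.Time, RVec n)) (q : P.Time × RVec m) : RVec n := P.f q.1 (x q.1) q.2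

variable (P) in
/-- The state derivative `∂f/∂x (t, x t, u)` along the curve `x`, as a function of `(t, u)`. -/
def jacobian (x : C(P.Time, RVec n)) (q : P.Time × RVec m) : RVec n →L[ℝ] RVec n :=
  fderiv ℝ (fun z => P.f q.1 z q.2) (x q.1)

variable (P) in
/-- The transpose of `jacobian`, which drives the costate equation. -/
def adjointJacobian (x : C(P.Time, RVec n)) (q : P.Time × RVec m) : RVec n →L[ℝ] RVec n :=
  ContinuousLinearMap.adjoint (P.jacobian x q)

namespace LipschitzC1InState

variable {L : ℝ} (h : P.LipschitzC1InState L)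
include h

theorem continuousOn_velocity (x : C(P.Time, RVec n)) :
    ContinuousOn (P.velocity x) P.timeInput :=
  h.continuousOn_field.comp (f := fun q : P.Time × RVec m => (q, x q.1)) (by fun_prop)
    fun _ hq => ⟨hq, Set.mem_univ _⟩

theorem continuousOn_jacobian (x : C(P.Time, RVec n)) :
    ContinuousOn (P.jacobian x) P.timeInput :=
  h.continuousOn_fderiv_field.comp (f := fun q : P.Time × RVec m => (q, x q.1)) (by fun_prop)
    fun _ hq => ⟨hq, Set.mem_univ _⟩

theorem continuousOn_adjointJacobian (x : C(P.Time, RVec n)) :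
    ContinuousOn (P.adjointJacobian x) P.timeInput :=
  (LinearIsometryEquiv.continuous _).comp_continuousOn (h.continuousOn_jacobian x)

theorem norm_velocity_sub_le (x x' : C(P.Time, RVec n)) {q : P.Time × RVec m}
    (hq : q ∈ P.timeInput) : ‖P.velocity x q - P.velocity x' q‖ ≤ L * ‖(x - x') q.1‖ :=
  h.lipschitz_field _ _ _ _ hq.2

theorem norm_jacobian_sub_le (x x' : C(P.Time, RVec n)) {q : P.Time × RVec m}
    (hq : q ∈ P.timeInput) : ‖P.jacobian x q - P.jacobian x' q‖ ≤ L * ‖(x - x') q.1‖ :=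
  h.lipschitz_fderiv_field _ _ _ _ hq.2

theorem norm_jacobian_le (x : C(P.Time, RVec n)) {q : P.Time × RVec m}
    (hq : q ∈ P.timeInput) : ‖P.jacobian x q‖ ≤ L :=
  norm_fderiv_le_of_lip' ℝ h.pos.le
    (.of_forall fun _ => h.lipschitz_field _ _ _ _ hq.2)

theorem norm_velocity_sub_sub_jacobian_le (x x' : C(P.Time, RVec n)) {q : P.Time × RVec m}
    (hq : q ∈ P.timeInput) :
    ‖P.velocity x' q - P.velocity x q - P.jacobian x q ((x' - x) q.1)‖
      ≤ L * ‖(x' - x) q.1‖ ^ 2 :=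
  norm_sub_sub_fderiv_le (h.differentiable_field _ _ hq.2) h.pos.le
    (fun _ _ => h.lipschitz_fderiv_field _ _ _ _ hq.2) (x q.1) (x' q.1)

theorem abs_cost_sub_sub_inner_gradient_le (x x' : RVec n) :
    |P.Ψ x' - P.Ψ x - inner ℝ (gradient P.Ψ x) (x' - x)| ≤ L * ‖x' - x‖ ^ 2 := by
  rw [inner_gradient_left]
  exact norm_sub_sub_fderiv_le h.differentiable_cost h.pos.le h.lipschitz_fderiv_cost x x'

theorem continuous_gradient : Continuous (gradient P.Ψ) := by
  have hfderiv : LipschitzWith L.toNNReal (fderiv ℝ P.Ψ) := .of_dist_le_mul fun x x' => by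
    simpa [dist_eq_norm, h.pos.le] using h.lipschitz_fderiv_cost x x'
  exact (LinearIsometryEquiv.continuous _).comp hfderiv.continuous

end LipschitzC1InState

/-! ### The state and costate equations -/

/-- The averaged velocity field of a relaxed input. -/
def stateField (μ : P.RelaxedInput) (s : P.Time) (z : RVec n) : RVec n :=
  ∫ u, P.f s z u ∂μ.kernel s

/-- The averaged linear vector field of the costate equation of a pair. -/
def costateField (y : P.Pair) (s : P.Time) (p : RVec n) : RVec n :=
  y.2.avg (P.adjointJacobian y.1) s p

namespace LipschitzC1InState

variable {L : ℝ} (h : P.LipschitzC1InState L)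
include h

theorem isLipschitzField_stateField (μ : P.RelaxedInput) :
    IsLipschitzField volume (stateField μ) L where
  aestronglyMeasurable x := (μ.integrable_avg (h.continuousOn_velocity x)).aestronglyMeasurable
  norm_sub_le := by
    filter_upwards [μ.ae_mem] with s hs z z'
    have hint (z : RVec n) : Integrable (fun u => P.f s z u) (μ.kernel s) :=
      integrable_of_continuousOn_of_ae_mem P.isCompact_U hs
        (continuousOn_slice (h.continuousOn_velocity (.const _ z)) s)
    refine norm_integral_sub_integral_le (hint z) (hint z') ?_
    filter_upwards [hs] with u hu using h.lipschitz_field s z z' u hu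
  bounded := by
    obtain ⟨B, hB⟩ := P.isCompact_timeInput.exists_bound_of_continuousOn
      (h.continuousOn_velocity 0)
    exact ⟨B, μ.ae_norm_avg_le hB⟩

theorem isLipschitzField_costateField (y : P.Pair) :
    IsLipschitzField volume (costateField y) L where
  aestronglyMeasurable p :=
    isBoundedBilinearMap_apply.continuous.comp_aestronglyMeasurable
      ((y.2.integrable_avg (h.continuousOn_adjointJacobian y.1)).aestronglyMeasurable.prodMk
        p.continuous.aestronglyMeasurable)
  norm_sub_le := by
    have hbound : ∀ q ∈ P.timeInput, ‖P.adjointJacobian y.1 q‖ ≤ L := fun q hq => by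
      rw [adjointJacobian, LinearIsometryEquiv.norm_map]
      exact h.norm_jacobian_le y.1 hq
    filter_upwards [y.2.ae_norm_avg_le hbound] with s hs p p'
    rw [costateField, costateField, ← map_sub]
    exact (y.2.avg (P.adjointJacobian y.1) s).le_of_opNorm_le hs _
  bounded := ⟨0, .of_forall fun s => by simp [costateField]⟩

theorem existsUnique_isTrajectory (μ : P.RelaxedInput) : ∃! x, P.IsTrajectory x μ :=
  P.isVolterra_Iic.existsUnique h.pos P.ξ (h.isLipschitzField_stateField μ)

theorem existsUnique_isCostate (y : P.Pair) : ∃! p, P.IsCostate y p :=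
  P.isVolterra_Ici.existsUnique h.pos _ (h.isLipschitzField_costateField y)

end LipschitzC1InState

/-- The trajectory of a relaxed input. -/
def trajectory (μ : P.RelaxedInput) : C(P.Time, RVec n) :=
  Classical.epsilon fun x => P.IsTrajectory x μ

namespace LipschitzC1InState

variable {L : ℝ} (h : P.LipschitzC1InState L)
include h

theorem isTrajectory_trajectory (μ : P.RelaxedInput) : P.IsTrajectory (trajectory μ) μ :=
  Classical.epsilon_spec (h.existsUnique_isTrajectory μ).exists

theorem isCostate_costate (y : P.Pair) : P.IsCostate y (P.costate y) :=
  Classical.epsilon_spec (h.existsUnique_isCostate y).exists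

theorem eq_trajectory {x : C(P.Time, RVec n)} {μ : P.RelaxedInput} (hx : P.IsTrajectory x μ) :
    x = trajectory μ :=
  (h.existsUnique_isTrajectory μ).unique hx (h.isTrajectory_trajectory μ)

end LipschitzC1InState

/-! ### Weak convergence of relaxed inputs -/

namespace RelaxedInput

theorem tendsto_iff {ι : Type*} {l : Filter ι} {a : ι → P.RelaxedInput} {μ : P.RelaxedInput} :
    Tendsto a l (𝓝 μ) ↔ ∀ ψ : BoundedContinuousFunction (P.Time × RVec m) ℝ,
      Tendsto (fun j => ∫ t, (a j).avg ψ t) l (𝓝 (∫ t, μ.avg ψ t)) := by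
  rw [nhds_induced, tendsto_comap_iff, FiniteMeasure.tendsto_iff_forall_integral_tendsto]
  simp only [integral_avg _ (BoundedContinuousFunction.continuous _).continuousOn]
  rfl

theorem integral_mul_avg_congr (μ : P.RelaxedInput) (g : P.Time → ℝ) {φ ψ : P.Time × RVec m → ℝ}
    (h : ∀ q ∈ P.timeInput, g q.1 * φ q = ψ q) :
    ∫ t, g t * μ.avg φ t = ∫ t, μ.avg ψ t := by
  refine integral_congr_ae ?_
  filter_upwards [μ.ae_mem] with t ht
  rw [avg, avg, ← integral_const_mul]
  refine integral_congr_ae ?_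
  filter_upwards [ht] with u hu using h _ (mem_timeInput hu)

theorem continuous_integral_mul_avg_of_continuous {g : P.Time → ℝ} (hg : Continuous g)
    {φ : P.Time × RVec m → ℝ} (hφ : ContinuousOn φ P.timeInput) :
    Continuous fun μ : P.RelaxedInput => ∫ t, g t * μ.avg φ t := by
  have hgφ : ContinuousOn (fun q => g q.1 * φ q) P.timeInput := by fun_prop
  have : CompactSpace P.timeInput := isCompact_iff_compactSpace.1 P.isCompact_timeInput
  obtain ⟨ψ, -, hψ⟩ := BoundedContinuousFunction.exists_norm_eq_domRestrict_eq_of_closed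
    (.mkOfCompact ⟨P.timeInput.domRestrict fun q => g q.1 * φ q, hgφ.domRestrict⟩)
    P.isCompact_timeInput.isClosed
  have hψ_eq (q) (hq : q ∈ P.timeInput) : g q.1 * φ q = ψ q :=
    (DFunLike.congr_fun hψ ⟨q, hq⟩).symm
  simp_rw [integral_mul_avg_congr _ g hψ_eq]
  exact continuous_iff_continuousAt.2 fun μ => tendsto_iff.1 tendsto_id ψ

theorem continuous_integral_mul_avg {g : P.Time → ℝ} (hg : Integrable g)
    {φ : P.Time × RVec m → ℝ} (hφ : ContinuousOn φ P.timeInput) :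
    Continuous fun μ : P.RelaxedInput => ∫ t, g t * μ.avg φ t := by
  obtain ⟨B, hB⟩ := P.isCompact_timeInput.exists_bound_of_continuousOn hφ
  refine continuous_of_uniform_approx_of_continuous fun V hV => ?_
  obtain ⟨ε, hε, hεV⟩ := Metric.mem_uniformity_dist.1 hV
  obtain ⟨c, hc, hc_int⟩ := hg.exists_boundedContinuous_integral_sub_le
    (by positivity : 0 < ε / (|B| + 1))
  refine ⟨_, continuous_integral_mul_avg_of_continuous c.continuous hφ, fun μ => hεV ?_⟩
  have hbound : ∀ᵐ t, ‖μ.avg φ t‖ ≤ |B| :=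
    μ.ae_norm_avg_le fun q hq => (hB q hq).trans (le_abs_self B)
  have hmul {d : P.Time → ℝ} (hd : Integrable d) : Integrable fun t => d t * μ.avg φ t :=
    hd.mul_bdd (μ.integrable_avg hφ).aestronglyMeasurable hbound
  rw [dist_eq_norm, ← integral_sub (hmul hg) (hmul hc_int)]
  calc ‖∫ t, (g t * μ.avg φ t - c t * μ.avg φ t)‖ ≤ ∫ t, ‖g t - c t‖ * |B| := by
        refine norm_integral_le_of_norm_le ((hg.sub hc_int).norm.mul_const _) ?_
        filter_upwards [hbound] with t ht
        rw [← sub_mul, norm_mul]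
        exact mul_le_mul_of_nonneg_left ht (norm_nonneg _)
    _ = (∫ t, ‖g t - c t‖) * |B| := integral_mul_const _ _
    _ ≤ ε / (|B| + 1) * |B| := mul_le_mul_of_nonneg_right hc (abs_nonneg B)
    _ < ε := by
      rw [div_mul_eq_mul_div, div_lt_iff₀ (by positivity)]
      linarith

variable {E : Type*} [NormedAddCommGroup E] [NormedSpace ℝ E]

theorem continuous_setIntegral_avg [FiniteDimensional ℝ E] {S : Set P.Time} (hS : MeasurableSet S)
    {φ : P.Time × RVec m → E} (hφ : ContinuousOn φ P.timeInput) :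
    Continuous fun μ : P.RelaxedInput => ∫ t in S, μ.avg φ t := by
  have : CompleteSpace E := FiniteDimensional.complete ℝ E
  have hfunctional (A : E →L[ℝ] ℝ) :
      Continuous fun μ : P.RelaxedInput => A (∫ t in S, μ.avg φ t) := by
    have hAφ : ContinuousOn (fun q => A (φ q)) P.timeInput := by fun_prop
    have hA (μ : P.RelaxedInput) : A (∫ t in S, μ.avg φ t)
        = ∫ t, S.indicator (fun _ => 1) t * μ.avg (fun q => A (φ q)) t := by
      rw [← ContinuousLinearMap.integral_comp_comm _ (μ.integrable_avg hφ).integrableOn,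
        ← integral_indicator hS]
      refine integral_congr_ae ?_
      filter_upwards [μ.ae_clm_avg (fun _ => A) hφ] with t ht
      by_cases hts : t ∈ S <;> simp [hts, ht]
    simp_rw [hA]
    exact continuous_integral_mul_avg ((integrable_const 1).indicator hS) hAφ
  let coord : E ≃L[ℝ] (Fin (Module.finrank ℝ E) → ℝ) :=
    (toEuclidean (E := E)).trans (EuclideanSpace.equiv _ ℝ)
  rw [← coord.toHomeomorph.comp_continuous_iff]
  refine continuous_pi fun i => ?_
  exact hfunctional ((ContinuousLinearMap.proj (R := ℝ) (φ := fun _ => ℝ) i).comp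
    (coord : E →L[ℝ] _))

theorem tendstoUniformly_setIntegral_avg [FiniteDimensional ℝ E] {I : P.Time → Set P.Time}
    (hI : IsVolterra volume I) {φ : P.Time × RVec m → E} (hφ : ContinuousOn φ P.timeInput)
    (μ : P.RelaxedInput) :
    TendstoUniformly (fun (μ' : P.RelaxedInput) t => ∫ s in I t, μ'.avg φ s)
      (fun t => ∫ s in I t, μ.avg φ s) (𝓝 μ) := by
  obtain ⟨B, hB⟩ := P.isCompact_timeInput.exists_bound_of_continuousOn hφ
  have hequi : Equicontinuous fun (μ' : P.RelaxedInput) t => ∫ s in I t, μ'.avg φ s := by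
    intro t₀
    refine Metric.equicontinuousAt_of_continuity_modulus
      (fun t => B * volume.real (symmDiff (I t₀) (I t))) ?_ _ (.of_forall fun t μ' => ?_)
    · simpa [symmDiff_comm] using (hI.tendsto_symmDiff t₀).const_mul B
    · rw [dist_eq_norm]
      exact norm_setIntegral_sub_setIntegral_le (hI.measurableSet _) (hI.measurableSet _)
        (μ'.integrable_avg hφ) (μ'.ae_norm_avg_le hB)
  exact UniformFun.tendsto_iff_tendstoUniformly.1 <|
    (hequi.tendsto_uniformFun_iff_pi _ _).2 <| tendsto_pi_nhds.2 fun t =>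
      (continuous_setIntegral_avg (hI.measurableSet t) hφ).tendsto μ

variable {ι : Type*} {l : Filter ι} {φ : ι → P.Time × RVec m → E} {φ₀ : P.Time × RVec m → E}

theorem tendstoUniformly_setIntegral_avg_of_tendstoUniformlyOn
    (hφ : ∀ j, ContinuousOn (φ j) P.timeInput) (hφ₀ : ContinuousOn φ₀ P.timeInput)
    (h : TendstoUniformlyOn φ φ₀ l P.timeInput) :
    TendstoUniformly (fun j (p : Set P.Time × P.RelaxedInput) => ∫ s in p.1, p.2.avg (φ j) s)
      (fun p => ∫ s in p.1, p.2.avg φ₀ s) l := by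
  set V := volume.real (Set.univ : Set P.Time)
  have : 0 ≤ V := measureReal_nonneg
  refine Metric.tendstoUniformly_iff.2 fun ε hε => ?_
  filter_upwards [Metric.tendstoUniformlyOn_iff.1 h (ε / (V + 1)) (by positivity)] with j hj p
  obtain ⟨S, μ⟩ := p
  have hbound : ∀ᵐ s, ‖μ.avg φ₀ s - μ.avg (φ j) s‖ ≤ ε / (V + 1) :=
    μ.ae_norm_avg_sub_avg_le hφ₀ (hφ j) fun q hq => by simpa [dist_eq_norm] using (hj q hq).le
  rw [dist_eq_norm, ← integral_sub (μ.integrable_avg hφ₀).integrableOn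
    (μ.integrable_avg (hφ j)).integrableOn]
  refine (norm_setIntegral_le_mul_measureReal_univ (by positivity) hbound S).trans_lt ?_
  rw [div_mul_eq_mul_div, div_lt_iff₀ (by positivity)]
  linarith

theorem tendstoUniformly_setIntegral_avg_of_tendsto [FiniteDimensional ℝ E]
    {I : P.Time → Set P.Time} (hI : IsVolterra volume I) {a : ι → P.RelaxedInput}
    {μ : P.RelaxedInput} (ha : Tendsto a l (𝓝 μ)) (hφ : ∀ j, ContinuousOn (φ j) P.timeInput)
    (hφ₀ : ContinuousOn φ₀ P.timeInput) (h : TendstoUniformlyOn φ φ₀ l P.timeInput) :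
    TendstoUniformly (fun j t => ∫ s in I t, (a j).avg (φ j) s)
      (fun t => ∫ s in I t, μ.avg φ₀ s) l := by
  refine Metric.tendstoUniformly_iff.2 fun ε hε => ?_
  filter_upwards [
    ha.eventually (Metric.tendstoUniformly_iff.1 (tendstoUniformly_setIntegral_avg hI hφ₀ μ)
      (ε / 2) (half_pos hε)),
    Metric.tendstoUniformly_iff.1
      (tendstoUniformly_setIntegral_avg_of_tendstoUniformlyOn hφ hφ₀ h) (ε / 2) (half_pos hε)]
    with j hμ hφj t
  exact (dist_triangle _ _ _).trans_lt ((add_lt_add (hμ t) (hφj (I t, a j))).trans_eq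
    (add_halves ε))

end RelaxedInput

/-! ### Continuous dependence on the relaxed input -/

namespace LipschitzC1InState

variable {L : ℝ} (h : P.LipschitzC1InState L)
include h

theorem continuous_trajectory : Continuous (trajectory (P := P)) :=
  continuous_iff_continuousAt.2 fun μ => by
    refine IsVolterraSolution.tendsto_of_tendstoUniformly P.isVolterra_Iic h.pos
      h.isLipschitzField_stateField h.isTrajectory_trajectory ?_
    have hμ : (fun _ => P.ξ) + (fun t => ∫ s in Set.Iic t, μ.avg (P.velocity (trajectory μ)) s)
        = ⇑(trajectory μ) :=
      (funext (h.isTrajectory_trajectory μ)).symm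
    have hsum := (tendsto_const_nhds (x := P.ξ)).tendstoUniformly_const.add
      (RelaxedInput.tendstoUniformly_setIntegral_avg P.isVolterra_Iic
        (h.continuousOn_velocity (trajectory μ)) μ)
    rw [hμ] at hsum
    exact hsum

theorem ae_costateField_apply (y : P.Pair) (p : C(P.Time, RVec n)) :
    ∀ᵐ s, costateField y s (p s) = y.2.avg (fun q => P.adjointJacobian y.1 q (p q.1)) s := by
  filter_upwards [y.2.ae_integrable (h.continuousOn_adjointJacobian y.1)] with s hs
    using ContinuousLinearMap.integral_apply hs _

theorem continuousOn_adjointJacobian_apply (x p : C(P.Time, RVec n)) :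
    ContinuousOn (fun q => P.adjointJacobian x q (p q.1)) P.timeInput :=
  (h.continuousOn_adjointJacobian x).clm_apply (by fun_prop)

theorem tendstoUniformlyOn_adjointJacobian_apply (x p : C(P.Time, RVec n)) :
    TendstoUniformlyOn (fun x' q => P.adjointJacobian x' q (p q.1))
      (fun q => P.adjointJacobian x q (p q.1)) (𝓝 x) P.timeInput := by
  refine Metric.tendstoUniformlyOn_iff.2 fun ε hε => ?_
  have hx : ∀ᶠ x' in 𝓝 x, L * ‖x - x'‖ * ‖p‖ < ε := by
    have : Continuous fun x' => L * ‖x - x'‖ * ‖p‖ := by fun_prop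
    exact this.tendsto x |>.eventually_lt_const (by simpa)
  filter_upwards [hx] with x' hx' q hq
  rw [dist_eq_norm, ← sub_apply]
  refine lt_of_le_of_lt ?_ hx'
  refine ContinuousLinearMap.le_of_opNorm_le_of_le _ ?_ (p.norm_coe_le_norm _)
  rw [adjointJacobian, adjointJacobian, ← map_sub, LinearIsometryEquiv.norm_map]
  exact (h.norm_jacobian_sub_le x x' hq).trans
    (mul_le_mul_of_nonneg_left ((x - x').norm_coe_le_norm _) h.pos.le)

theorem continuous_costate : Continuous P.costate :=
  continuous_iff_continuousAt.2 fun y => by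
    refine IsVolterraSolution.tendsto_of_tendstoUniformly P.isVolterra_Ici h.pos
      h.isLipschitzField_costateField h.isCostate_costate ?_
    set p := P.costate y
    have hfield (y' : P.Pair) (t : P.Time) : ∫ s in Set.Ici t, costateField y' s (p s)
        = ∫ s in Set.Ici t, y'.2.avg (fun q => P.adjointJacobian y'.1 q (p q.1)) s :=
      integral_congr_ae (ae_restrict_of_ae (h.ae_costateField_apply y' p))
    have hp : (fun _ => gradient P.Ψ (y.1 P.finalTime))
        + (fun t => ∫ s in Set.Ici t, y.2.avg (fun q => P.adjointJacobian y.1 q (p q.1)) s)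
        = ⇑p :=
      (funext fun t => (h.isCostate_costate y t).trans (congrArg _ (hfield y t))).symm
    have hgradient : Tendsto (fun y' : P.Pair => gradient P.Ψ (y'.1 P.finalTime)) (𝓝 y)
        (𝓝 (gradient P.Ψ (y.1 P.finalTime))) :=
      (h.continuous_gradient.comp (by fun_prop)).tendsto y
    have hintegral := RelaxedInput.tendstoUniformly_setIntegral_avg_of_tendsto P.isVolterra_Ici
      (continuous_snd.tendsto y)
      (fun y' : P.Pair => h.continuousOn_adjointJacobian_apply y'.1 p)
      (h.continuousOn_adjointJacobian_apply y.1 p)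
      fun V hV => (continuous_fst.tendsto y).eventually
        (h.tendstoUniformlyOn_adjointJacobian_apply y.1 p V hV)
    have hsum := hgradient.tendstoUniformly_const.add hintegral
    simp_rw [hfield]
    rw [hp] at hsum
    exact hsum

theorem isClosed_relaxedPairs : IsClosed P.relaxedPairs := by
  have : P.relaxedPairs = {y | y.1 = trajectory y.2} := Set.ext fun y =>
    ⟨h.eq_trajectory, fun hy => by
      rw [relaxedPairs, Set.mem_ofPred_eq, hy]
      exact h.isTrajectory_trajectory y.2⟩
  rw [this]
  exact isClosed_eq continuous_fst (h.continuous_trajectory.comp continuous_snd)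

theorem continuous_cost : Continuous P.cost :=
  continuous_coe_real_ereal.comp (h.differentiable_cost.continuous.comp (by fun_prop))

end LipschitzC1InState

end ControlProblem

/-! ### Convex combinations and empirical inputs -/

section Kernel

variable {α β : Type*} [MeasurableSpace α] [MeasurableSpace β]

/-- The convex combination `(1 - ε) κ + ε κ'` of two kernels. -/
def convexCombKernel (κ κ' : Kernel α β) (ε : unitInterval) : Kernel α β where
  toFun a := ENNReal.ofReal (1 - ε) • κ a + ENNReal.ofReal ε • κ' a
  measurable' := Measure.measurable_of_measurable_coe _ fun s hs => by
    simp only [Measure.coe_add, Measure.coe_smul, Pi.add_apply, Pi.smul_apply, smul_eq_mul]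
    exact ((κ.measurable_coe hs).const_mul _).add ((κ'.measurable_coe hs).const_mul _)

variable {κ κ' : Kernel α β} {ε : unitInterval}

theorem convexCombKernel_apply (a : α) : convexCombKernel κ κ' ε a
    = ENNReal.ofReal (1 - ε) • κ a + ENNReal.ofReal ε • κ' a := rfl

instance [IsMarkovKernel κ] [IsMarkovKernel κ'] : IsMarkovKernel (convexCombKernel κ κ' ε) where
  isProbabilityMeasure a := ⟨by
    rw [convexCombKernel_apply]
    simp [← ENNReal.ofReal_add (sub_nonneg.2 ε.2.2) ε.2.1]⟩

theorem ae_convexCombKernel {a : α} {p : β → Prop} (h : ∀ᵐ b ∂κ a, p b) (h' : ∀ᵐ b ∂κ' a, p b) :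
    ∀ᵐ b ∂convexCombKernel κ κ' ε a, p b :=
  ae_add_measure_iff.2 ⟨Measure.ae_smul_measure h _, Measure.ae_smul_measure h' _⟩

theorem integral_convexCombKernel {E : Type*} [NormedAddCommGroup E] [NormedSpace ℝ E] {a : α}
    {g : β → E} (h : Integrable g (κ a)) (h' : Integrable g (κ' a)) :
    ∫ b, g b ∂convexCombKernel κ κ' ε a
      = (1 - ε : ℝ) • (∫ b, g b ∂κ a) + (ε : ℝ) • ∫ b, g b ∂κ' a := by
  rw [convexCombKernel_apply, integral_add_measure (h.smul_measure ENNReal.ofReal_ne_top)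
    (h'.smul_measure ENNReal.ofReal_ne_top), integral_smul_measure, integral_smul_measure,
    ENNReal.toReal_ofReal (sub_nonneg.2 ε.2.2), ENNReal.toReal_ofReal ε.2.1]

end Kernel

theorem exists_measurable_nearest {X : Type*} [PseudoEMetricSpace X] [MeasurableSpace X]
    [OpensMeasurableSpace X] {N : ℕ} (hN : 0 < N) (v : Fin N → X) :
    ∃ ind : X → Fin N, Measurable ind ∧ ∀ x i, edist (v (ind x)) x ≤ edist (v i) x := by
  let c (k : ℕ) : Fin N := ⟨min k (N - 1), by omega⟩
  refine ⟨c ∘ SimpleFunc.nearestPtInd (v ∘ c) (N - 1),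
    Measurable.of_discrete.comp (SimpleFunc.nearestPtInd (v ∘ c) (N - 1)).measurable, fun x i => ?_⟩
  have hc : c i = i := Fin.ext (by simp only [c]; omega)
  have h := SimpleFunc.edist_nearestPt_le (v ∘ c) x (k := i) (N := N - 1) (by omega)
  rwa [Function.comp_apply, hc] at h

theorem map_comp_eq_sum_smul_dirac {α β ι : Type*} [MeasurableSpace α] [MeasurableSpace β]
    [Fintype ι] [MeasurableSpace ι] [DiscreteMeasurableSpace ι] {ind : α → ι}
    (hind : Measurable ind) (v : ι → β) (κ : Measure α) :
    κ.map (v ∘ ind) = ∑ i, κ (ind ⁻¹' {i}) • Measure.dirac (v i) := by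
  have hv : Measurable v := .of_discrete
  rw [← Measure.map_map hv hind, ← Measure.sum_smul_dirac (κ.map ind), Measure.sum_fintype,
    Measure.map_finset_sum' hv.aemeasurable]
  refine Finset.sum_congr rfl fun i _ => ?_
  rw [Measure.map_smul, Measure.map_dirac' hv,
    Measure.map_apply hind (measurableSet_singleton i)]

namespace ControlProblem

variable {n m : ℕ} {P : ControlProblem n m}

namespace RelaxedInput

/-- The relaxed input given by a Markov kernel that is almost everywhere concentrated on `U`. -/
def ofKernel (κ : Kernel P.Time (RVec m)) [hκ : IsMarkovKernel κ]
    (h : ∀ᵐ t, ∀ᵐ u ∂κ t, u ∈ P.U) : P.RelaxedInput where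
  kernel := κ
  isMarkov := hκ
  support_subset := h.mono fun _ => Measure.support_subset_of_isClosed P.isCompact_U.isClosed

/-- The convex combination `(1 - ε) μ + ε μ'`. -/
def mix (μ μ' : P.RelaxedInput) (ε : unitInterval) : P.RelaxedInput :=
  ofKernel (convexCombKernel μ.kernel μ'.kernel ε) <| by
    filter_upwards [μ.ae_mem, μ'.ae_mem] with t ht ht' using ae_convexCombKernel ht ht'

theorem ae_avg_mix (μ μ' : P.RelaxedInput) (ε : unitInterval) {E : Type*} [NormedAddCommGroup E]
    [NormedSpace ℝ E] {φ : P.Time × RVec m → E} (hφ : ContinuousOn φ P.timeInput) :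
    ∀ᵐ t, (μ.mix μ' ε).avg φ t = (1 - ε : ℝ) • μ.avg φ t + (ε : ℝ) • μ'.avg φ t := by
  filter_upwards [μ.ae_integrable hφ, μ'.ae_integrable hφ] with t ht ht'
    using integral_convexCombKernel ht ht'

end RelaxedInput

theorem isEmpirical_iff {N : ℕ} {v : Fin N → RVec m} {μ : P.RelaxedInput} :
    P.IsEmpirical v μ ↔ 0 < N ∧ ∀ᵐ t, ∀ᵐ u ∂μ.kernel t, u ∈ Set.range v := by
  constructor
  · rintro ⟨w, -, -, hsum, hμ⟩
    refine ⟨Nat.pos_of_ne_zero ?_, ?_⟩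
    · rintro rfl
      simpa using hsum P.finalTime
    · filter_upwards [hμ] with t ht
      rw [ht, ae_iff]
      simp [Measure.finsetSum_apply]
  · rintro ⟨hN, hμ⟩
    obtain ⟨ind, hind, hnearest⟩ := exists_measurable_nearest hN v
    refine ⟨fun i t => (μ.kernel t).real (ind ⁻¹' {i}),
      fun i => (μ.kernel.measurable_coe (hind (measurableSet_singleton i))).ennreal_toReal,
      fun _ _ => measureReal_nonneg, fun t => ?_, ?_⟩
    · simpa using sum_measureReal_preimage_singleton (μ := μ.kernel t) (f := ind) Finset.univ
        fun i _ => hind (measurableSet_singleton i)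
    · filter_upwards [hμ] with t ht
      have hid : v ∘ ind =ᵐ[μ.kernel t] id := by
        filter_upwards [ht]
        rintro _ ⟨i, rfl⟩
        simpa using hnearest (v i) i
      simp only [ofReal_measureReal (measure_ne_top _ _)]
      rw [← map_comp_eq_sum_smul_dirac hind, Measure.map_congr hid, Measure.map_id]

theorem IsEmpirical.mix {N : ℕ} {v : Fin N → RVec m} {μ μ' : P.RelaxedInput}
    (hμ : P.IsEmpirical v μ) (hμ' : P.IsEmpirical v μ') (ε : unitInterval) :
    P.IsEmpirical v (μ.mix μ' ε) := by
  obtain ⟨hN, hμ⟩ := isEmpirical_iff.1 hμ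
  obtain ⟨-, hμ'⟩ := isEmpirical_iff.1 hμ'
  refine isEmpirical_iff.2 ⟨hN, ?_⟩
  filter_upwards [hμ, hμ'] with t ht ht' using ae_convexCombKernel ht ht'

end ControlProblem

/-! ### First variation of the cost -/

section Pairing

variable {α F : Type*} [MeasurableSpace α] {vol : Measure α} [NormedAddCommGroup F]
  [InnerProductSpace ℝ F]

theorem integrable_inner_of_continuousMap [TopologicalSpace α] [CompactSpace α]
    [OpensMeasurableSpace α] [SecondCountableTopologyEither α F] (p : C(α, F)) {g : α → F}
    (hg : Integrable g vol) : Integrable (fun t => inner ℝ (p t) (g t)) vol :=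
  (innerSL ℝ).integrable_of_bilin_of_bdd_left ‖p‖ p.continuous.aestronglyMeasurable
    (.of_forall p.norm_coe_le_norm) hg

theorem integral_inner_setIntegral_Ici [CompleteSpace F] [TopologicalSpace α] [PartialOrder α]
    [OrderClosedTopology α] [SecondCountableTopology α] [OpensMeasurableSpace α] [SFinite vol]
    {D q : α → F} (hD : Integrable D vol) (hq : Integrable q vol) :
    ∫ t, inner ℝ (∫ s in Set.Ici t, q s ∂vol) (D t) ∂vol
      = ∫ s, inner ℝ (q s) (∫ t in Set.Iic s, D t ∂vol) ∂vol := by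
  let k (z : α × α) : ℝ := inner ℝ (q z.2) (D z.1)
  have hk : Integrable k (vol.prod vol) := by
    refine (hD.norm.mul_prod hq.norm).mono' (hq.1.comp_snd.inner hD.1.comp_fst)
      (.of_forall fun z => ?_)
    rw [mul_comm]
    exact norm_inner_le_norm _ _
  have hswap := integral_integral_swap
    (f := fun t s => {z : α × α | z.1 ≤ z.2}.indicator k (t, s))
    (hk.indicator (measurableSet_le measurable_fst measurable_snd))
  convert hswap using 3 with t s
  · rw [real_inner_comm, ← integral_inner hq.integrableOn, ← integral_indicator measurableSet_Ici]
    exact integral_congr_ae (.of_forall fun s => by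
      by_cases hts : t ≤ s <;> simp [k, hts, real_inner_comm])
  · rw [← integral_inner hD.integrableOn, ← integral_indicator measurableSet_Iic]
    exact integral_congr_ae (.of_forall fun t => by
      by_cases hts : t ≤ s <;> simp [k, hts])

end Pairing

namespace ControlProblem

variable {n m : ℕ} {P : ControlProblem n m}

variable (P) in
/-- The Hamiltonian `p tᵀ f (t, x t, u)` along a pair and its costate, as a function of `(t, u)`. -/
def hamiltonianAlong (y : P.Pair) (q : P.Time × RVec m) : ℝ :=
  inner ℝ (P.costate y q.1) (P.velocity y.1 q)

variable (P) in
/-- The directional derivative of the cost at `y = (x, μ)` along the segment from `μ` to `μ'`, which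
is the increment of the integrated Hamiltonian. -/
def firstVariation (y : P.Pair) (μ' : P.RelaxedInput) : ℝ :=
  (∫ t, μ'.avg (P.hamiltonianAlong y) t) - ∫ t, y.2.avg (P.hamiltonianAlong y) t

namespace LipschitzC1InState

variable {L : ℝ} (h : P.LipschitzC1InState L)
include h

theorem continuousOn_hamiltonianAlong (y : P.Pair) :
    ContinuousOn (P.hamiltonianAlong y) P.timeInput :=
  ContinuousOn.inner ((P.costate y).continuous.comp continuous_fst).continuousOn
    (h.continuousOn_velocity y.1)

theorem firstVariation_eq_integral_inner (y : P.Pair) (μ' : P.RelaxedInput) :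
    P.firstVariation y μ' = ∫ t, inner ℝ (P.costate y t)
      (μ'.avg (P.velocity y.1) t - y.2.avg (P.velocity y.1) t) := by
  have hH := h.continuousOn_hamiltonianAlong y
  have hv := h.continuousOn_velocity y.1
  rw [firstVariation, ← integral_sub (μ'.integrable_avg hH) (y.2.integrable_avg hH)]
  refine integral_congr_ae ?_
  filter_upwards [μ'.ae_inner_avg (P.costate y) hv, y.2.ae_inner_avg (P.costate y) hv]
    with t ht' ht
  rw [inner_sub_right, ht', ht]
  rfl

theorem exists_norm_trajectory_mix_sub_le {y : P.Pair} (hy : P.IsTrajectory y.1 y.2)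
    (μ' : P.RelaxedInput) :
    ∃ K, ∀ ε : unitInterval, ‖trajectory (y.2.mix μ' ε) - y.1‖ ≤ K * ε := by
  obtain ⟨C, -, hC⟩ := P.isVolterra_Iic.exists_norm_sub_le_of_defect (E := RVec n) h.pos
  have hφ := h.continuousOn_velocity y.1
  set φ := P.velocity y.1
  obtain ⟨B, hB⟩ := P.isCompact_timeInput.exists_bound_of_continuousOn hφ
  replace hB q hq : ‖φ q‖ ≤ |B| := (hB q hq).trans (le_abs_self B)
  set V : ℝ := (volume : Measure P.Time).real Set.univ
  refine ⟨C * (2 * |B| * V), fun ε => ?_⟩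
  have hε : (0 : ℝ) ≤ ε := ε.2.1
  have hdefect (t : P.Time) :
      ‖y.1 t - (P.ξ + ∫ s in Set.Iic t, (y.2.mix μ' ε).avg φ s)‖ ≤ ε * (2 * |B|) * V := by
    rw [hy t, add_sub_add_left_eq_sub]
    change ‖(∫ s in Set.Iic t, y.2.avg φ s) - _‖ ≤ _
    rw [← integral_sub (y.2.integrable_avg hφ).integrableOn
      ((y.2.mix μ' ε).integrable_avg hφ).integrableOn]
    refine norm_setIntegral_le_mul_measureReal_univ (by positivity) ?_ _
    filter_upwards [y.2.ae_avg_mix μ' ε hφ, y.2.ae_norm_avg_le hB, μ'.ae_norm_avg_le hB]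
      with s hmix hs hs'
    rw [hmix, show y.2.avg φ s - ((1 - ε : ℝ) • y.2.avg φ s + (ε : ℝ) • μ'.avg φ s)
      = (ε : ℝ) • (y.2.avg φ s - μ'.avg φ s) by module, norm_smul, Real.norm_of_nonneg hε, two_mul]
    exact mul_le_mul_of_nonneg_left ((norm_sub_le _ _).trans (add_le_add hs hs')) hε
  rw [norm_sub_rev]
  refine (hC (h.isLipschitzField_stateField _) (h.isTrajectory_trajectory _) hdefect).trans_eq ?_
  ring

theorem ae_inner_avg_jacobian_apply (y : P.Pair) (p Δ : C(P.Time, RVec n)) :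
    ∀ᵐ t, inner ℝ (p t) (y.2.avg (fun q => P.jacobian y.1 q (Δ q.1)) t)
      = inner ℝ (costateField y t (p t)) (Δ t) := by
  filter_upwards [y.2.ae_inner_avg p ((h.continuousOn_jacobian y.1).clm_apply
      (g := fun q => Δ q.1) (by fun_prop)), h.ae_costateField_apply y p,
    y.2.ae_inner_avg Δ (h.continuousOn_adjointJacobian_apply y.1 p)] with t hjac hfield hadj
  rw [hjac, hfield, real_inner_comm, hadj]
  simp only [adjointJacobian, ContinuousLinearMap.adjoint_inner_right, real_inner_comm]

/-- Exchanging the order of integration turns the linear term of the costate equation into minus the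
Jacobian term of the linearized state equation. -/
theorem inner_gradient_eq_integral_inner_costate (y : P.Pair) {D : P.Time → RVec n}
    (hD : Integrable D) {Δ : C(P.Time, RVec n)} (hΔ : ∀ t, Δ t = ∫ s in Set.Iic t, D s) :
    inner ℝ (gradient P.Ψ (y.1 P.finalTime)) (Δ P.finalTime) = ∫ t, inner ℝ (P.costate y t)
      (D t - y.2.avg (fun q => P.jacobian y.1 q (Δ q.1)) t) := by
  set c := gradient P.Ψ (y.1 P.finalTime)
  set p := P.costate y
  set q := fun s => costateField y s (p s)
  have hq : Integrable q := (h.isLipschitzField_costateField y).integrable h.pos.le p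
  have hp (t : P.Time) : p t = c + ∫ s in Set.Ici t, q s := h.isCostate_costate y t
  have hJ : Integrable (y.2.avg fun q => P.jacobian y.1 q (Δ q.1)) :=
    y.2.integrable_avg ((h.continuousOn_jacobian y.1).clm_apply (by fun_prop))
  have hΔT : ∫ t, D t = Δ P.finalTime := by
    rw [hΔ, show Set.Iic P.finalTime = Set.univ from Set.eq_univ_of_forall fun t => t.2.2,
      Measure.restrict_univ]
  calc inner ℝ c (Δ P.finalTime)
      = (∫ t, inner ℝ (p t) (D t)) - ∫ t, inner ℝ (p t - c) (D t) := by
        simp_rw [inner_sub_left]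
        rw [integral_sub (integrable_inner_of_continuousMap p hD) (hD.const_inner c),
          integral_inner hD, hΔT, sub_sub_cancel]
    _ = (∫ t, inner ℝ (p t) (D t)) - ∫ t, inner ℝ (q t) (Δ t) := by
        simp_rw [hp, add_sub_cancel_left, hΔ]
        rw [integral_inner_setIntegral_Ici hD hq]
    _ = _ := by
        simp_rw [inner_sub_right]
        rw [integral_sub (integrable_inner_of_continuousMap p hD)
          (integrable_inner_of_continuousMap p hJ),
          integral_congr_ae (h.ae_inner_avg_jacobian_apply y p Δ)]

theorem ae_norm_avg_mix_sub_le (y : P.Pair) (μ' : P.RelaxedInput) (ε : unitInterval)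
    {x : C(P.Time, RVec n)} {r : ℝ} (hx : ‖x - y.1‖ ≤ r) :
    ∀ᵐ t, ‖((y.2.mix μ' ε).avg (P.velocity x) t - y.2.avg (P.velocity y.1) t
        - y.2.avg (fun q => P.jacobian y.1 q ((x - y.1) q.1)) t)
      - (ε : ℝ) • (μ'.avg (P.velocity y.1) t - y.2.avg (P.velocity y.1) t)‖
      ≤ L * r ^ 2 + 2 * ε * (L * r) := by
  have hφ := h.continuousOn_velocity y.1
  have hψ := h.continuousOn_velocity x
  have hχ := (h.continuousOn_jacobian y.1).clm_apply (g := fun q => (x - y.1) q.1) (by fun_prop)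
  set φ := P.velocity y.1
  set ψ := P.velocity x
  set χ := fun q => P.jacobian y.1 q ((x - y.1) q.1)
  have hL := h.pos.le
  have hr (t : P.Time) : ‖(x - y.1) t‖ ≤ r := ((x - y.1).norm_coe_le_norm t).trans hx
  have hlip : ∀ q ∈ P.timeInput, ‖ψ q - φ q‖ ≤ L * r := fun q hq =>
    (h.norm_velocity_sub_le x y.1 hq).trans (by gcongr; exact hr q.1)
  have htaylor : ∀ q ∈ P.timeInput, ‖ψ q - (φ + χ) q‖ ≤ L * r ^ 2 := fun q hq => by
    rw [Pi.add_apply, ← sub_sub]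
    exact (h.norm_velocity_sub_sub_jacobian_le y.1 x hq).trans (by gcongr; exact hr q.1)
  filter_upwards [y.2.ae_avg_mix μ' ε hψ, y.2.ae_norm_avg_sub_avg_le hψ (hφ.add hχ) htaylor,
    y.2.ae_norm_avg_sub_avg_le hψ hφ hlip, μ'.ae_norm_avg_sub_avg_le hψ hφ hlip,
    y.2.ae_integrable hφ, y.2.ae_integrable hχ] with t hmix hquad hlin hlin' hφt hχt
  have hadd : y.2.avg (φ + χ) t = y.2.avg φ t + y.2.avg χ t := integral_add hφt hχt
  calc _ = ‖(y.2.avg ψ t - y.2.avg (φ + χ) t) + (ε : ℝ) • ((μ'.avg ψ t - μ'.avg φ t)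
          - (y.2.avg ψ t - y.2.avg φ t))‖ := by
        rw [hmix, hadd]
        congr 1
        module
    _ ≤ L * r ^ 2 + ε * (L * r + L * r) := by
        refine norm_add_le_of_le hquad ?_
        rw [norm_smul, Real.norm_of_nonneg ε.2.1]
        exact mul_le_mul_of_nonneg_left (norm_sub_le_of_le hlin' hlin) ε.2.1
    _ = L * r ^ 2 + 2 * ε * (L * r) := by ring

theorem exists_abs_inner_gradient_trajectory_mix_sub_sub_firstVariation_le {y : P.Pair}
    (hy : P.IsTrajectory y.1 y.2) (μ' : P.RelaxedInput) :
    ∃ C, ∀ ε : unitInterval,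
      |inner ℝ (gradient P.Ψ (y.1 P.finalTime)) ((trajectory (y.2.mix μ' ε) - y.1) P.finalTime)
        - ε * P.firstVariation y μ'| ≤ C * (ε : ℝ) ^ 2 := by
  obtain ⟨K, hK⟩ := h.exists_norm_trajectory_mix_sub_le hy μ'
  refine ⟨‖P.costate y‖ * (L * K ^ 2 + 2 * (L * K)) * (volume : Measure P.Time).real Set.univ,
    fun ε => ?_⟩
  set x := trajectory (y.2.mix μ' ε)
  set p := P.costate y
  have hφ := h.continuousOn_velocity y.1
  have hψ := (y.2.mix μ' ε).integrable_avg (h.continuousOn_velocity x)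
  have hD : Integrable fun t => (y.2.mix μ' ε).avg (P.velocity x) t
      - y.2.avg (P.velocity y.1) t := hψ.sub (y.2.integrable_avg hφ)
  have hres : Integrable fun t => (y.2.mix μ' ε).avg (P.velocity x) t
      - y.2.avg (P.velocity y.1) t - y.2.avg (fun q => P.jacobian y.1 q ((x - y.1) q.1)) t :=
    hD.sub (y.2.integrable_avg ((h.continuousOn_jacobian y.1).clm_apply (by fun_prop)))
  have hΔ (t : P.Time) : (x - y.1) t = ∫ s in Set.Iic t,
      ((y.2.mix μ' ε).avg (P.velocity x) s - y.2.avg (P.velocity y.1) s) := by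
    rw [integral_sub hψ.integrableOn (y.2.integrable_avg hφ).integrableOn,
      ContinuousMap.sub_apply, h.isTrajectory_trajectory (y.2.mix μ' ε) t, hy t,
      add_sub_add_left_eq_sub]
    rfl
  have hvar : Integrable fun t => μ'.avg (P.velocity y.1) t - y.2.avg (P.velocity y.1) t :=
    (μ'.integrable_avg hφ).sub (y.2.integrable_avg hφ)
  rw [h.inner_gradient_eq_integral_inner_costate y hD hΔ, h.firstVariation_eq_integral_inner,
    ← integral_const_mul, ← integral_sub (integrable_inner_of_continuousMap p hres)
      ((integrable_inner_of_continuousMap p hvar).const_mul _), ← Real.norm_eq_abs]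
  refine (norm_integral_le_of_norm_le_const (C := ‖p‖ * (L * (K * ε) ^ 2 + 2 * ε * (L * (K * ε))))
    ?_).trans_eq (by ring)
  filter_upwards [h.ae_norm_avg_mix_sub_le y μ' ε (hK ε)] with t ht
  rw [← real_inner_smul_right, ← inner_sub_right]
  exact (norm_inner_le_norm _ _).trans
    (mul_le_mul (p.norm_coe_le_norm t) ht (norm_nonneg _) (norm_nonneg _))

theorem exists_abs_cost_trajectory_mix_sub_sub_firstVariation_le {y : P.Pair}
    (hy : P.IsTrajectory y.1 y.2) (μ' : P.RelaxedInput) :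
    ∃ C, ∀ ε : unitInterval,
      |P.Ψ (trajectory (y.2.mix μ' ε) P.finalTime) - P.Ψ (y.1 P.finalTime)
        - ε * P.firstVariation y μ'| ≤ C * (ε : ℝ) ^ 2 := by
  obtain ⟨K, hK⟩ := h.exists_norm_trajectory_mix_sub_le hy μ'
  obtain ⟨C, hC⟩ := h.exists_abs_inner_gradient_trajectory_mix_sub_sub_firstVariation_le hy μ'
  refine ⟨L * K ^ 2 + C, fun ε => ?_⟩
  set x := trajectory (y.2.mix μ' ε)
  have hnorm : ‖x P.finalTime - y.1 P.finalTime‖ ≤ K * ε :=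
    ((x - y.1).norm_coe_le_norm P.finalTime).trans (hK ε)
  have hquad : L * ‖x P.finalTime - y.1 P.finalTime‖ ^ 2 ≤ L * (K * ε) ^ 2 :=
    mul_le_mul_of_nonneg_left (pow_le_pow_left₀ (norm_nonneg _) hnorm 2) h.pos.le
  calc _ ≤ _ := abs_sub_le _ (inner ℝ (gradient P.Ψ (y.1 P.finalTime))
          (x P.finalTime - y.1 P.finalTime)) _
    _ ≤ L * (K * ε) ^ 2 + C * (ε : ℝ) ^ 2 :=
        add_le_add ((h.abs_cost_sub_sub_inner_gradient_le _ _).trans hquad) (hC ε)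
    _ = (L * K ^ 2 + C) * (ε : ℝ) ^ 2 := by ring

theorem firstVariation_nonneg {y : P.Pair} (hy : P.IsTrajectory y.1 y.2) {μ' : P.RelaxedInput}
    (hmin : ∀ ε, P.Ψ (y.1 P.finalTime) ≤ P.Ψ (trajectory (y.2.mix μ' ε) P.finalTime)) :
    0 ≤ P.firstVariation y μ' := by
  obtain ⟨C, hC⟩ := h.exists_abs_cost_trajectory_mix_sub_sub_firstVariation_le hy μ'
  have hlower : ∀ᶠ ε : ℝ in 𝓝[>] 0, -(C * ε) ≤ P.firstVariation y μ' := by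
    filter_upwards [Ioc_mem_nhdsGT one_pos] with ε hε
    have hΨ := hmin ⟨ε, hε.1.le, hε.2⟩
    have hexp := (abs_le.1 (hC ⟨ε, hε.1.le, hε.2⟩)).2
    refine le_of_mul_le_mul_left ?_ hε.1
    dsimp only at hexp
    linarith
  refine le_of_tendsto ?_ hlower
  have : Tendsto (fun ε : ℝ => -(C * ε)) (𝓝 0) (𝓝 (-(C * 0))) := Continuous.tendsto (by fun_prop) 0
  simpa using this.mono_left nhdsWithin_le_nhds

end LipschitzC1InState

end ControlProblem

/-! ### Variations as differences of relaxed inputs -/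

section SignedMeasure

theorem support_subset_iff_ae_mem {X : Type*} [TopologicalSpace X] [MeasurableSpace X]
    [HereditarilyLindelofSpace X] {ρ : Measure X} {S : Set X} (hS : IsClosed S) :
    ρ.support ⊆ S ↔ ∀ᵐ u ∂ρ, u ∈ S :=
  ⟨mem_of_superset Measure.support_mem_ae, Measure.support_subset_of_isClosed hS⟩

theorem exists_isMarkovKernel_ae_toSignedMeasure_eq {α β : Type*} [MeasurableSpace α]
    [MeasurableSpace β] [Nonempty β] {vol : Measure α} {s : α → SignedMeasure β}
    (hs : ∀ B, MeasurableSet B → Measurable fun t => s t B) (hs₀ : ∀ᵐ t ∂vol, 0 ≤ s t)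
    (hs₁ : ∀ᵐ t ∂vol, s t Set.univ = 1) :
    ∃ (κ : Kernel α β) (_ : IsMarkovKernel κ), ∀ᵐ t ∂vol, (κ t).toSignedMeasure = s t := by
  classical
  obtain ⟨G, hG, hGm, hGs⟩ := (hs₀.and hs₁).exists_measurable_mem
  have hpos (t) (ht : t ∈ G) : 0 ≤[Set.univ] s t :=
    (VectorMeasure.le_restrict_univ_iff_le _ _).2 (hGs t ht).1
  let b : β := Classical.arbitrary β
  let ρ (t : α) : Measure β := if ht : t ∈ G
    then (s t).toMeasureOfZeroLE Set.univ .univ (hpos t ht) else Measure.dirac b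
  have hρ {t} (ht : t ∈ G) {B : Set β} (hB : MeasurableSet B) :
      ρ t B = ENNReal.ofReal (s t B) := by
    simp only [ρ, dif_pos ht]
    rw [← ofReal_measureReal, SignedMeasure.toMeasureOfZeroLE_real_apply _ _ _ hB, Set.univ_inter]
  have hmeas : Measurable ρ := Measure.measurable_of_measurable_coe _ fun B hB => by
    have hpiece : (fun t => ρ t B)
        = G.piecewise (fun t => ENNReal.ofReal (s t B)) fun _ => Measure.dirac b B := by
      ext t
      by_cases ht : t ∈ G
      · simp only [ht, Set.piecewise_eq_of_mem, hρ ht hB]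
      · simp only [ρ, ht, dif_neg, not_false_eq_true, Set.piecewise_eq_of_notMem]
    rw [hpiece]
    exact (hs B hB).ennreal_ofReal.piecewise hGm measurable_const
  have hprob (t) : IsProbabilityMeasure (ρ t) := by
    by_cases ht : t ∈ G
    · exact ⟨by rw [hρ ht .univ, (hGs t ht).2, ENNReal.ofReal_one]⟩
    · simp only [ρ, dif_neg ht]
      infer_instance
  refine ⟨⟨ρ, hmeas⟩, ⟨hprob⟩, mem_of_superset hG fun t ht => ?_⟩
  have hκ : ρ t = (s t).toMeasureOfZeroLE Set.univ .univ (hpos t ht) := dif_pos ht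
  change (ρ t).toSignedMeasure = s t
  simp only [hκ, SignedMeasure.toMeasureOfZeroLE_toSignedMeasure]

variable {n m : ℕ}

theorem signedSupport_toSignedMeasure (ρ : Measure (RVec m)) [IsFiniteMeasure ρ] :
    signedSupport ρ.toSignedMeasure = ρ.support := by
  rw [signedSupport, SignedMeasure.totalVariation_eq_variation,
    Measure.variation_toSignedMeasure]

theorem signedSupport_neg (δ : SignedMeasure (RVec m)) :
    signedSupport (-δ) = signedSupport δ := by
  rw [signedSupport, SignedMeasure.totalVariation_neg, signedSupport]

theorem signedSupport_add_subset (δ δ' : SignedMeasure (RVec m)) :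
    signedSupport (δ + δ') ⊆ signedSupport δ ∪ signedSupport δ' := by
  simp only [signedSupport, SignedMeasure.totalVariation_eq_variation, ← Measure.support_add]
  exact Measure.support_mono VectorMeasure.variation_add_le

theorem signedIntegral_sub (ρ κ : Measure (RVec m)) [IsFiniteMeasure ρ] [IsFiniteMeasure κ]
    {g : RVec m → RVec n} (hρ : Integrable g ρ) (hκ : Integrable g κ) :
    signedIntegral (ρ.toSignedMeasure - κ.toSignedMeasure) g = (∫ u, g u ∂ρ) - ∫ u, g u ∂κ := by
  have hmeasure : ρ + (κ - ρ) = κ + (ρ - κ) := by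
    have hsub := Measure.sub_toSignedMeasure_eq_toSignedMeasure_sub (μ := ρ) (ν := κ)
    rw [sub_eq_sub_iff_add_eq_add] at hsub
    rw [← Measure.toSignedMeasure_eq_toSignedMeasure_iff, Measure.toSignedMeasure_add,
      Measure.toSignedMeasure_add, hsub, add_comm]
  have hintegral : ∫ u, g u ∂(ρ + (κ - ρ)) = ∫ u, g u ∂(κ + (ρ - κ)) := by rw [hmeasure]
  rw [integral_add_measure hρ (hκ.mono_measure Measure.sub_le),
    integral_add_measure hκ (hρ.mono_measure Measure.sub_le)] at hintegral
  rw [signedIntegral, Measure.toJordanDecomposition_toSignedMeasure_sub,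
    Measure.jordanDecompositionOfToSignedMeasureSub_posPart,
    Measure.jordanDecompositionOfToSignedMeasureSub_negPart, sub_eq_sub_iff_add_eq_add, hintegral,
    add_comm]

end SignedMeasure

namespace ControlProblem

variable {n m : ℕ} {P : ControlProblem n m}

/-- The variation `μ' - μ`. -/
def variation (μ μ' : P.RelaxedInput) (t : P.Time) : SignedMeasure (RVec m) :=
  (μ'.kernel t).toSignedMeasure - (μ.kernel t).toSignedMeasure

theorem variation_add (μ μ' : P.RelaxedInput) (t : P.Time) :
    variation μ μ' t + (μ.kernel t).toSignedMeasure = (μ'.kernel t).toSignedMeasure :=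
  sub_add_cancel _ _

theorem isVariation_variation (μ μ' : P.RelaxedInput) : P.IsVariation μ (variation μ μ') where
  measurable B hB := by
    simp only [variation, Measure.toSignedMeasure_sub_apply hB]
    exact (μ'.kernel.measurable_coe hB).ennreal_toReal.sub
      (μ.kernel.measurable_coe hB).ennreal_toReal
  nonneg := .of_forall fun t => by
    rw [variation_add]
    exact Measure.zero_le_toSignedMeasure _
  mass_zero := .of_forall fun t => by
    rw [variation, Measure.toSignedMeasure_sub_apply .univ, probReal_univ, probReal_univ, sub_self]

theorem IsVariation.exists_relaxedInput {μ : P.RelaxedInput}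
    {δ : P.Time → SignedMeasure (RVec m)} (hδ : P.IsVariation μ δ)
    (hU : ∀ᵐ t, signedSupport (δ t + (μ.kernel t).toSignedMeasure) ⊆ P.U) :
    ∃ μ' : P.RelaxedInput, ∀ᵐ t, δ t = variation μ μ' t := by
  have hmeas (B) (hB : MeasurableSet B) :
      Measurable fun t => (δ t + (μ.kernel t).toSignedMeasure) B := by
    simp only [_root_.add_apply, Measure.toSignedMeasure_apply_measurable hB]
    exact (hδ.measurable B hB).add (μ.kernel.measurable_coe hB).ennreal_toReal
  have hmass : ∀ᵐ t, (δ t + (μ.kernel t).toSignedMeasure) Set.univ = 1 := by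
    filter_upwards [hδ.mass_zero] with t ht
    rw [_root_.add_apply, ht, Measure.toSignedMeasure_apply_measurable .univ, probReal_univ,
      zero_add]
  obtain ⟨κ, hκ, hδκ⟩ := exists_isMarkovKernel_ae_toSignedMeasure_eq hmeas hδ.nonneg hmass
  refine ⟨.ofKernel κ ?_, hδκ.mono fun t ht => eq_sub_of_add_eq ht.symm⟩
  filter_upwards [hδκ, hU] with t ht hUt
  rwa [← support_subset_iff_ae_mem P.isCompact_U.isClosed, ← signedSupport_toSignedMeasure, ht]

theorem signedSupport_variation_subset {μ μ' : P.RelaxedInput} {t : P.Time} {S : Set (RVec m)}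
    (hμ : (μ.kernel t).support ⊆ S) (hμ' : (μ'.kernel t).support ⊆ S) :
    signedSupport (variation μ μ' t) ⊆ S := by
  rw [variation, sub_eq_add_neg]
  refine (signedSupport_add_subset _ _).trans (Set.union_subset ?_ ?_)
  · rwa [signedSupport_toSignedMeasure]
  · rwa [signedSupport_neg, signedSupport_toSignedMeasure]

theorem signedSupport_add_kernel_subset {μ : P.RelaxedInput} {t : P.Time}
    {δ : SignedMeasure (RVec m)} {S : Set (RVec m)} (hδ : signedSupport δ ⊆ S)
    (hμ : (μ.kernel t).support ⊆ S) :
    signedSupport (δ + (μ.kernel t).toSignedMeasure) ⊆ S :=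
  (signedSupport_add_subset _ _).trans
    (Set.union_subset hδ (by rwa [signedSupport_toSignedMeasure]))

theorem isEmpirical_iff_support_subset {N : ℕ} {v : Fin N → RVec m} {μ : P.RelaxedInput} :
    P.IsEmpirical v μ ↔ 0 < N ∧ ∀ᵐ t, (μ.kernel t).support ⊆ Set.range v := by
  simp only [isEmpirical_iff, support_subset_iff_ae_mem (Set.finite_range v).isClosed]

theorem firstVariation_self (y : P.Pair) : P.firstVariation y y.2 = 0 := sub_self _

/-! ### The optimality functions as infima of the first variation -/

namespace LipschitzC1InState

variable {L : ℝ} (h : P.LipschitzC1InState L)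
include h

theorem integral_hamiltonian_variation (y : P.Pair) (μ' : P.RelaxedInput) :
    ∫ t, P.hamiltonian t (y.1 t) (variation y.2 μ' t) (P.costate y t) = P.firstVariation y μ' := by
  have hv := h.continuousOn_velocity y.1
  rw [h.firstVariation_eq_integral_inner]
  refine integral_congr_ae ?_
  filter_upwards [y.2.ae_integrable hv, μ'.ae_integrable hv] with t ht ht'
  exact congrArg _ (signedIntegral_sub _ _ ht' ht)

theorem hamiltonianValue_eq_iInf {y : P.Pair} {C : (P.Time → SignedMeasure (RVec m)) → Prop}
    {A : Set P.RelaxedInput} (hA : ∀ μ' ∈ A, C (variation y.2 μ'))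
    (hC : ∀ δ, P.IsVariation y.2 δ → C δ → ∃ μ' ∈ A, ∀ᵐ t, δ t = variation y.2 μ' t) :
    P.hamiltonianValue y C = ⨅ μ' ∈ A, (P.firstVariation y μ' : EReal) := by
  refine le_antisymm (le_iInf₂ fun μ' hμ' => ?_) (le_iInf₂ fun δ hδ => ?_)
  · rw [← h.integral_hamiltonian_variation]
    exact iInf₂_le (variation y.2 μ') ⟨isVariation_variation _ _, hA μ' hμ'⟩
  · obtain ⟨μ', hμ', hδμ'⟩ := hC δ hδ.1 hδ.2
    refine (iInf₂_le μ' hμ').trans_eq ?_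
    rw [← h.integral_hamiltonian_variation]
    exact congrArg _ (integral_congr_ae (hδμ'.mono fun t ht => by simp only [ht]))

theorem thetaH_eq_iInf (y : P.Pair) :
    P.thetaH y = ⨅ μ' : P.RelaxedInput, (P.firstVariation y μ' : EReal) := by
  rw [← iInf_univ]
  refine h.hamiltonianValue_eq_iInf (fun μ' _ => ?_) fun δ hδ hU => ?_
  · simpa only [variation_add, signedSupport_toSignedMeasure] using μ'.support_subset
  · simpa only [Set.mem_univ, true_and] using hδ.exists_relaxedInput hU

theorem hamiltonianValue_signedSupport_subset_eq_iInf {y : P.Pair} {S : P.Time → Set (RVec m)}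
    (hS : ∀ᵐ t, S t ⊆ P.U) (hy : ∀ᵐ t, (y.2.kernel t).support ⊆ S t) :
    P.hamiltonianValue y (fun δ => ∀ᵐ t, signedSupport (δ t) ⊆ S t)
      = ⨅ μ' ∈ {μ' : P.RelaxedInput | ∀ᵐ t, (μ'.kernel t).support ⊆ S t},
        (P.firstVariation y μ' : EReal) := by
  refine h.hamiltonianValue_eq_iInf (fun μ' hμ' => ?_) fun δ hδ hδS => ?_
  · filter_upwards [hy, hμ'] with t ht ht' using signedSupport_variation_subset ht ht'
  · have hadd : ∀ᵐ t, signedSupport (δ t + (y.2.kernel t).toSignedMeasure) ⊆ S t := by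
      filter_upwards [hδS, hy] with t hδt ht using signedSupport_add_kernel_subset hδt ht
    obtain ⟨μ', hμ'⟩ := hδ.exists_relaxedInput (by
      filter_upwards [hadd, hS] with t ht hSt using ht.trans hSt)
    refine ⟨μ', ?_, hμ'⟩
    filter_upwards [hadd, hμ'] with t ht hμ't
    rwa [hμ't, variation_add, signedSupport_toSignedMeasure] at ht

theorem thetaNH_eq_iInf (y : P.Pair) :
    P.thetaNH y
      = ⨅ μ' ∈ {μ' : P.RelaxedInput | ∀ᵐ t, (μ'.kernel t).support ⊆ (y.2.kernel t).support},
        (P.firstVariation y μ' : EReal) :=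
  h.hamiltonianValue_signedSupport_subset_eq_iInf y.2.support_subset
    (.of_forall fun _ => subset_rfl)

theorem thetaH_le_thetaNH (y : P.Pair) : P.thetaH y ≤ P.thetaNH y := by
  rw [h.thetaH_eq_iInf, h.thetaNH_eq_iInf]
  exact le_iInf₂ fun μ' _ => iInf_le _ μ'

variable {N : ℕ} {v : Fin N → RVec m} (hv : ∀ i, v i ∈ P.U) {y : P.Pair}
  (hy : P.IsEmpirical v y.2)
include hv hy

theorem thetaSample_eq_iInf :
    P.thetaSample v y = ⨅ μ' ∈ {μ' : P.RelaxedInput | P.IsEmpirical v μ'},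
      (P.firstVariation y μ' : EReal) := by
  obtain ⟨hN, hsupp⟩ := isEmpirical_iff_support_subset.1 hy
  simp only [isEmpirical_iff_support_subset, hN, true_and]
  exact h.hamiltonianValue_signedSupport_subset_eq_iInf
    (.of_forall fun _ => Set.range_subset_iff.2 hv) hsupp

theorem thetaH_le_thetaSample : P.thetaH y ≤ P.thetaSample v y := by
  rw [h.thetaH_eq_iInf, h.thetaSample_eq_iInf hv hy]
  exact le_iInf₂ fun μ' _ => iInf_le _ μ'

theorem thetaNH_le_thetaSample (hfull : ∀ᵐ t, Set.range v ⊆ (y.2.kernel t).support) :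
    P.thetaNH y ≤ P.thetaSample v y := by
  rw [h.thetaNH_eq_iInf, h.thetaSample_eq_iInf hv hy]
  refine iInf_le_iInf_of_subset fun μ' hμ' => ?_
  filter_upwards [(isEmpirical_iff_support_subset.1 hμ').2, hfull] with t ht ht' using ht.trans ht'

end LipschitzC1InState

end ControlProblem

/-! ### Asymptotic density of random samples -/

section Sampling

/-- The `N`-th family of points consists of `N` points of `S`, and each point of `S` is a limit of
points of the families. -/
structure AsymptoticallyDense {X : Type*} [TopologicalSpace X] (v : (N : ℕ) → Fin N → X)
    (S : Set X) : Prop where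
  mem : ∀ N i, v N i ∈ S
  eventually_exists_mem : ∀ u ∈ S, ∀ O ∈ 𝓝 u, ∀ᶠ N in atTop, ∃ i, v N i ∈ O

variable {X Ω : Type*} [MeasurableSpace X] [MeasurableSpace Ω] {Pr : Measure Ω}
  {ν : Measure X} {v : (N : ℕ) → Fin N → Ω → X}

theorem measure_forall_notMem_eq_pow {ι : Type*} [Fintype ι] {w : ι → Ω → X}
    (hlaw : ∀ i, HasLaw (w i) ν Pr) (hindep : iIndepFun w Pr) {O : Set X} (hO : MeasurableSet O) :
    Pr {ω | ∀ i, w i ω ∉ O} = ν Oᶜ ^ Fintype.card ι := by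
  have hinter := hindep.measure_inter_preimage_eq_mul Finset.univ (sets := fun _ => Oᶜ)
    fun i _ => hO.compl
  have hone (i) : Pr (w i ⁻¹' Oᶜ) = ν Oᶜ := (hlaw i).measure_eq (p := fun x => x ∈ Oᶜ) hO.compl
  simp only [hone, Finset.prod_const, Finset.card_univ] at hinter
  rw [← hinter]
  congr 1
  ext ω
  simp

variable [IsProbabilityMeasure ν]

theorem ae_eventually_exists_mem (hlaw : ∀ N i, HasLaw (v N i) ν Pr)
    (hindep : ∀ N, iIndepFun (v N) Pr) {O : Set X} (hO : MeasurableSet O) (hpos : ν O ≠ 0) :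
    ∀ᵐ ω ∂Pr, ∀ᶠ N in atTop, ∃ i, v N i ω ∈ O := by
  have hlt : ν Oᶜ < 1 := by
    rw [prob_compl_eq_one_sub hO]
    exact ENNReal.sub_lt_self ENNReal.one_ne_top one_ne_zero hpos
  have hsum : ∑' N, Pr {ω | ∀ i, v N i ω ∉ O} ≠ ⊤ := by
    simp_rw [measure_forall_notMem_eq_pow (hlaw _) (hindep _) hO, Fintype.card_fin]
    rw [ENNReal.tsum_geometric]
    exact ENNReal.inv_ne_top.2 (tsub_pos_of_lt hlt).ne'
  filter_upwards [ae_eventually_notMem hsum] with ω hω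
  filter_upwards [hω] with N hN
  simpa using hN

theorem ae_asymptoticallyDense [TopologicalSpace X] [SecondCountableTopology X]
    [OpensMeasurableSpace X] (hlaw : ∀ N i, HasLaw (v N i) ν Pr)
    (hindep : ∀ N, iIndepFun (v N) Pr) :
    ∀ᵐ ω ∂Pr, AsymptoticallyDense (fun N i => v N i ω) ν.support := by
  have hmem : ∀ᵐ ω ∂Pr, ∀ N i, v N i ω ∈ ν.support :=
    ae_all_iff.2 fun N => ae_all_iff.2 fun i =>
      ((hlaw N i).ae_iff (measurable_mem.2 Measure.isClosed_support.measurableSet)).2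
        Measure.support_mem_ae
  have hbasis : ∀ᵐ ω ∂Pr, ∀ O ∈ TopologicalSpace.countableBasis X, ν O ≠ 0 →
      ∀ᶠ N in atTop, ∃ i, v N i ω ∈ O := by
    refine (ae_ball_iff (TopologicalSpace.countable_countableBasis X)).2 fun O hO => ?_
    by_cases hnull : ν O = 0
    · exact .of_forall fun ω hpos => absurd hnull hpos
    filter_upwards [ae_eventually_exists_mem hlaw hindep
      (TopologicalSpace.isOpen_of_mem_countableBasis hO).measurableSet hnull] with ω hω _ using hω
  filter_upwards [hmem, hbasis] with ω hω hωbasis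
  refine ⟨hω, fun u hu O hO => ?_⟩
  obtain ⟨O', hO', huO', hsub⟩ :=
    (TopologicalSpace.isBasis_countableBasis X).mem_nhds_iff.1 hO
  have hpos : 0 < ν O' := (Measure.mem_support_iff_forall u).1 hu O'
    ((TopologicalSpace.isOpen_of_mem_countableBasis hO').mem_nhds huO')
  filter_upwards [hωbasis O' hO' hpos.ne'] with N ⟨i, hi⟩ using ⟨i, hsub hi⟩

end Sampling

/-! ### Empirical inputs are dense in the limit -/

section NearestSample

variable {X : Type*} [PseudoEMetricSpace X] [MeasurableSpace X] [OpensMeasurableSpace X]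

/-- A measurable map to a nearest point among the samples `v`; the identity if there are none. -/
def nearestSample {N : ℕ} (v : Fin N → X) (x : X) : X :=
  if hN : 0 < N then v ((exists_measurable_nearest hN v).choose x) else x

variable {N : ℕ} {v : Fin N → X}

theorem measurable_nearestSample : Measurable (nearestSample v) := by
  unfold nearestSample
  split_ifs with hN
  · exact Measurable.of_discrete.comp (exists_measurable_nearest hN v).choose_spec.1
  · exact measurable_id

theorem nearestSample_mem_range (hN : 0 < N) (x : X) : nearestSample v x ∈ Set.range v := by
  rw [nearestSample, dif_pos hN]
  exact Set.mem_range_self _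

theorem nearestSample_mem {S : Set X} (hv : ∀ i, v i ∈ S) {x : X} (hx : x ∈ S) :
    nearestSample v x ∈ S := by
  rw [nearestSample]
  split_ifs with hN
  exacts [hv _, hx]

theorem edist_nearestSample_le (x : X) (i : Fin N) :
    edist (nearestSample v x) x ≤ edist (v i) x := by
  rw [nearestSample, dif_pos i.pos]
  exact (exists_measurable_nearest i.pos v).choose_spec.2 x i

theorem AsymptoticallyDense.tendsto_nearestSample {v : (N : ℕ) → Fin N → X} {S : Set X}
    (hv : AsymptoticallyDense v S) {u : X} (hu : u ∈ S) :
    Tendsto (fun N => nearestSample (v N) u) atTop (𝓝 u) := by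
  refine EMetric.tendsto_nhds.2 fun ε hε => ?_
  filter_upwards [hv.eventually_exists_mem u hu _ (Metric.eball_mem_nhds u hε)] with N ⟨i, hi⟩
  exact (edist_nearestSample_le u i).trans_lt hi

end NearestSample

section AddDiracs

variable {α β : Type*} [MeasurableSpace α] [MeasurableSpace β]

theorem absolutelyContinuous_convexCombKernel {κ κ' : Kernel α β} {ε : unitInterval} (hε : 0 < ε)
    {a : α} : κ' a ≪ convexCombKernel κ κ' ε a := by
  rw [convexCombKernel_apply]
  exact (Measure.absolutelyContinuous_smul (ENNReal.ofReal_pos.2 hε).ne').add_right _ |>.trans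
    (by rw [add_comm])

/-- The average of a Markov kernel and the point masses at `v i`, with equal weights. -/
def addDiracsKernel {N : ℕ} (κ : Kernel α β) (v : Fin N → β) : Kernel α β where
  toFun a := ((N : ENNReal) + 1)⁻¹ • (κ a + ∑ i, Measure.dirac (v i))
  measurable' := Measure.measurable_of_measurable_coe _ fun s hs => by
    simp only [Measure.coe_add, Measure.coe_smul, Pi.add_apply, Pi.smul_apply, smul_eq_mul]
    exact ((κ.measurable_coe hs).add_const _).const_mul _

variable {N : ℕ} {κ : Kernel α β} {v : Fin N → β}

theorem addDiracsKernel_apply (a : α) : addDiracsKernel κ v a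
    = ((N : ENNReal) + 1)⁻¹ • (κ a + ∑ i, Measure.dirac (v i)) := rfl

instance isMarkovKernel_addDiracsKernel [IsMarkovKernel κ] :
    IsMarkovKernel (addDiracsKernel κ v) where
  isProbabilityMeasure a := ⟨by
    rw [addDiracsKernel_apply, Measure.smul_apply, Measure.add_apply, Measure.finsetSum_apply]
    simp only [measure_univ, Finset.sum_const, Finset.card_univ, Fintype.card_fin, nsmul_one,
      smul_eq_mul]
    rw [add_comm (1 : ENNReal)]
    exact ENNReal.inv_mul_cancel (by simp) (by simp)⟩

theorem ae_addDiracsKernel [MeasurableSingletonClass β] {a : α} {p : β → Prop}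
    (h : ∀ᵐ b ∂κ a, p b) (hv : ∀ i, p (v i)) : ∀ᵐ b ∂addDiracsKernel κ v a, p b := by
  refine Measure.ae_smul_measure (ae_add_measure_iff.2 ⟨h, ?_⟩) _
  exact ae_finsetSum_measure_iff.2 fun i _ => by simpa using hv i

theorem dirac_absolutelyContinuous_addDiracsKernel {a : α} (i : Fin N) :
    Measure.dirac (v i) ≪ addDiracsKernel κ v a := by
  refine .trans ?_ (Measure.absolutelyContinuous_smul (by simp))
  refine (Measure.absolutelyContinuous_of_le ?_)
  exact (Finset.single_le_sum (f := fun i => Measure.dirac (v i)) (fun _ _ => bot_le)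
    (Finset.mem_univ i)).trans (Measure.le_add_left le_rfl)

end AddDiracs

namespace ControlProblem

variable {n m : ℕ} {P : ControlProblem n m}

namespace RelaxedInput

/-- The image of a relaxed input under a measurable map of the input set to itself. -/
def map (μ : P.RelaxedInput) {π : RVec m → RVec m} (hπ : Measurable π)
    (hU : Set.MapsTo π P.U P.U) : P.RelaxedInput :=
  have := Kernel.IsMarkovKernel.map μ.kernel hπ
  ofKernel (μ.kernel.map π) <| by
    filter_upwards [μ.ae_mem] with t ht
    rw [Kernel.map_apply _ hπ]
    exact (ae_map_iff hπ.aemeasurable P.isCompact_U.measurableSet).2 (ht.mono hU)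

theorem integral_avg_map (μ : P.RelaxedInput) {π : RVec m → RVec m} (hπ : Measurable π)
    (hU : Set.MapsTo π P.U P.U) (ψ : BoundedContinuousFunction (P.Time × RVec m) ℝ) :
    ∫ t, (μ.map hπ hU).avg ψ t
      = ∫ q, ψ (q.1, π q.2) ∂((volume : Measure P.Time) ⊗ₘ μ.kernel) := by
  have hmeas : Measurable fun q : P.Time × RVec m => ψ (q.1, π q.2) := by fun_prop
  rw [Measure.integral_compProd (.of_bound hmeas.aestronglyMeasurable ‖ψ‖
    (.of_forall fun q => ψ.norm_coe_le_norm _))]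
  refine integral_congr_ae (.of_forall fun t => ?_)
  change ∫ u, ψ (t, u) ∂μ.kernel.map π t = ∫ u, ψ (t, π u) ∂μ.kernel t
  have hψ : Continuous fun u => ψ (t, u) := by fun_prop
  rw [Kernel.map_apply _ hπ, integral_map hπ.aemeasurable hψ.aestronglyMeasurable]

theorem tendsto_map (μ : P.RelaxedInput) {π : ℕ → RVec m → RVec m} (hπ : ∀ N, Measurable (π N))
    (hU : ∀ N, Set.MapsTo (π N) P.U P.U)
    (hlim : ∀ u ∈ P.U, Tendsto (fun N => π N u) atTop (𝓝 u)) :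
    Tendsto (fun N => μ.map (hπ N) (hU N)) atTop (𝓝 μ) := by
  refine tendsto_iff.2 fun ψ => ?_
  simp only [integral_avg_map]
  rw [μ.integral_avg ψ.continuous.continuousOn]
  have hmeas (N) : Measurable fun q : P.Time × RVec m => ψ (q.1, π N q.2) := by fun_prop
  refine tendsto_integral_of_dominated_convergence (fun _ => ‖ψ‖)
    (fun N => (hmeas N).aestronglyMeasurable)
    (integrable_const _) (fun N => .of_forall fun q => ψ.norm_coe_le_norm _) ?_
  filter_upwards [μ.ae_mem_timeInput] with q hq
  exact (ψ.continuous.tendsto q).comp (tendsto_const_nhds.prodMk_nhds (hlim q.2 hq.2))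

theorem tendsto_mix {ι : Type*} {l : Filter ι} {a : ι → P.RelaxedInput} {μ : P.RelaxedInput}
    (ha : Tendsto a l (𝓝 μ)) (b : ι → P.RelaxedInput) {ε : ι → unitInterval}
    (hε : Tendsto ε l (𝓝 0)) : Tendsto (fun j => (a j).mix (b j) (ε j)) l (𝓝 μ) := by
  refine tendsto_iff.2 fun ψ => ?_
  have hψ := ψ.continuous.continuousOn (s := P.timeInput)
  have hmix (j) : ∫ t, ((a j).mix (b j) (ε j)).avg ψ t
      = (1 - ε j : ℝ) * (∫ t, (a j).avg ψ t) + ε j * ∫ t, (b j).avg ψ t := by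
    simp only [integral_congr_ae ((a j).ae_avg_mix (b j) (ε j) hψ), smul_eq_mul]
    rw [integral_add (((a j).integrable_avg hψ).const_mul _)
      (((b j).integrable_avg hψ).const_mul _), integral_const_mul, integral_const_mul]
  have hbound (j) : ‖∫ t, (b j).avg ψ t‖ ≤ ‖ψ‖ * (volume : Measure P.Time).real Set.univ :=
    norm_integral_le_of_norm_le_const
      ((b j).ae_norm_avg_le fun q _ => ψ.norm_coe_le_norm q)
  have hε' : Tendsto (fun j => (ε j : ℝ)) l (𝓝 0) :=
    (continuous_subtype_val.tendsto (0 : unitInterval)).comp hε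
  have hvanish : Tendsto (fun j => ε j * ∫ t, (b j).avg ψ t) l (𝓝 0) :=
    hε'.zero_mul_isBoundedUnder_le (isBoundedUnder_of ⟨_, hbound⟩)
  simp only [hmix]
  simpa using ((hε'.const_sub 1).mul (tendsto_iff.1 ha ψ)).add hvanish

/-- The average of a relaxed input and the point masses at the samples; its support contains every
sample. -/
def withSamples (μ : P.RelaxedInput) {N : ℕ} {v : Fin N → RVec m} (hv : ∀ i, v i ∈ P.U) :
    P.RelaxedInput :=
  ofKernel (addDiracsKernel μ.kernel v) <| by
    filter_upwards [μ.ae_mem] with t ht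
    exact ae_addDiracsKernel ht hv

theorem range_subset_support_mix_withSamples (μ μ' : P.RelaxedInput) {N : ℕ} {v : Fin N → RVec m}
    (hv : ∀ i, v i ∈ P.U) {ε : unitInterval} (hε : 0 < ε) (t : P.Time) :
    Set.range v ⊆ ((μ.mix (μ'.withSamples hv) ε).kernel t).support := by
  rintro _ ⟨i, rfl⟩
  have hmix : (μ'.withSamples hv).kernel t ≪ (μ.mix (μ'.withSamples hv) ε).kernel t :=
    absolutelyContinuous_convexCombKernel hε
  refine ((dirac_absolutelyContinuous_addDiracsKernel i).trans hmix).support_mono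
    ((Measure.mem_support_iff_forall _).2 fun O hO => ?_)
  rw [Measure.dirac_apply_of_mem (mem_of_mem_nhds hO)]
  exact one_pos

end RelaxedInput

theorem IsEmpirical.withSamples {N : ℕ} {v : Fin N → RVec m} {μ : P.RelaxedInput}
    (hμ : P.IsEmpirical v μ) (hv : ∀ i, v i ∈ P.U) : P.IsEmpirical v (μ.withSamples hv) := by
  obtain ⟨hN, hμ⟩ := isEmpirical_iff.1 hμ
  exact isEmpirical_iff.2 ⟨hN, hμ.mono fun t ht => ae_addDiracsKernel ht Set.mem_range_self⟩

theorem isEmpirical_map_nearestSample (μ : P.RelaxedInput) {N : ℕ} (hN : 0 < N)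
    {v : Fin N → RVec m} (hU : Set.MapsTo (nearestSample v) P.U P.U) :
    P.IsEmpirical v (μ.map measurable_nearestSample hU) := by
  refine isEmpirical_iff.2 ⟨hN, .of_forall fun t => ?_⟩
  change ∀ᵐ u ∂μ.kernel.map (nearestSample v) t, u ∈ Set.range v
  rw [Kernel.map_apply _ measurable_nearestSample]
  exact (ae_map_iff measurable_nearestSample.aemeasurable (Set.finite_range v).measurableSet).2
    (.of_forall (nearestSample_mem_range hN))

theorem exists_isEmpirical_tendsto {v : (N : ℕ) → Fin N → RVec m} (hv : AsymptoticallyDense v P.U)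
    (μ : P.RelaxedInput) : ∃ a : ℕ → P.RelaxedInput,
      (∀ N, 0 < N → P.IsEmpirical (v N) (a N)) ∧
      (∀ N, ∀ t, Set.range (v N) ⊆ ((a N).kernel t).support) ∧ Tendsto a atTop (𝓝 μ) := by
  have hU (N) : Set.MapsTo (nearestSample (v N)) P.U P.U := fun u hu =>
    nearestSample_mem (hv.mem N) hu
  let b (N) : P.RelaxedInput := μ.map measurable_nearestSample (hU N)
  let ε (N : ℕ) : unitInterval := ⟨1 / ((N : ℝ) + 1), by positivity,
    (div_le_one₀ (by positivity)).2 (by simp)⟩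
  have hε₀ (N) : 0 < ε N := Subtype.mk_lt_mk.2 Nat.one_div_pos_of_nat
  have hε : Tendsto ε atTop (𝓝 0) := tendsto_subtype_rng.2 tendsto_one_div_add_atTop_nhds_zero_nat
  refine ⟨fun N => (b N).mix ((b N).withSamples (hv.mem N)) (ε N), fun N hN => ?_,
    fun N => RelaxedInput.range_subset_support_mix_withSamples _ _ _ (hε₀ N),
    RelaxedInput.tendsto_mix (μ.tendsto_map (fun _ => measurable_nearestSample) hU
      fun u hu => hv.tendsto_nearestSample hu) _ hε⟩
  have hb := isEmpirical_map_nearestSample μ hN (hU N)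
  exact hb.mix (hb.withSamples (hv.mem N)) (ε N)

end ControlProblem

/-! ### Semicontinuity of the optimality functions -/

theorem iInf_coe_le_liminf_of_tendstoUniformly {ι X : Type*} {l : Filter ι} {F : ι → X → ℝ}
    {f : X → ℝ} (h : TendstoUniformly F f l) :
    ⨅ x, (f x : EReal) ≤ liminf (fun j => ⨅ x, (F j x : EReal)) l := by
  refine le_of_forall_lt fun c hc => ?_
  obtain ⟨s, hcs, hs⟩ := EReal.lt_iff_exists_real_btwn.1 hc
  obtain ⟨r, hsr, hr⟩ := EReal.lt_iff_exists_real_btwn.1 hs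
  refine hcs.trans_le (le_liminf_of_le (by isBoundedDefault) ?_)
  have hgap : 0 < r - s := sub_pos.2 (EReal.coe_lt_coe_iff.1 hsr)
  filter_upwards [Metric.tendstoUniformly_iff.1 h _ hgap] with j hj
  refine le_iInf fun x => EReal.coe_le_coe_iff.2 ?_
  have hrx : r ≤ f x := EReal.coe_le_coe_iff.1 (hr.le.trans (iInf_le _ x))
  have hdist := (abs_lt.1 (hj x)).2
  linarith

namespace ControlProblem

variable {n m : ℕ} {P : ControlProblem n m}

namespace LipschitzC1InState

variable {L : ℝ} (h : P.LipschitzC1InState L)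
include h

theorem norm_hamiltonianAlong_sub_le {B : ℝ} (y y' : P.Pair) {q : P.Time × RVec m}
    (hq : q ∈ P.timeInput) (hB : ‖P.velocity y.1 q‖ ≤ B) :
    ‖P.hamiltonianAlong y q - P.hamiltonianAlong y' q‖
      ≤ ‖P.costate y - P.costate y'‖ * B + ‖P.costate y'‖ * (L * ‖y.1 - y'.1‖) := by
  have hvelocity : ‖P.velocity y.1 q - P.velocity y'.1 q‖ ≤ L * ‖y.1 - y'.1‖ :=
    (h.norm_velocity_sub_le y.1 y'.1 hq).trans
      (mul_le_mul_of_nonneg_left ((y.1 - y'.1).norm_coe_le_norm q.1) h.pos.le)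
  have hsplit : P.hamiltonianAlong y q - P.hamiltonianAlong y' q
      = inner ℝ ((P.costate y - P.costate y') q.1) (P.velocity y.1 q)
        + inner ℝ (P.costate y' q.1) (P.velocity y.1 q - P.velocity y'.1 q) := by
    simp only [hamiltonianAlong, ContinuousMap.sub_apply, inner_sub_left, inner_sub_right]
    ring
  rw [hsplit]
  refine (norm_add_le _ _).trans (add_le_add ?_ ?_)
  · exact (norm_inner_le_norm _ _).trans
      (mul_le_mul (ContinuousMap.norm_coe_le_norm _ _) hB (norm_nonneg _) (norm_nonneg _))
  · exact (norm_inner_le_norm _ _).trans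
      (mul_le_mul (ContinuousMap.norm_coe_le_norm _ _) hvelocity (norm_nonneg _) (norm_nonneg _))

theorem tendstoUniformlyOn_hamiltonianAlong (y : P.Pair) :
    TendstoUniformlyOn P.hamiltonianAlong (P.hamiltonianAlong y) (𝓝 y) P.timeInput := by
  obtain ⟨B, hB⟩ := P.isCompact_timeInput.exists_bound_of_continuousOn
    (h.continuousOn_velocity y.1)
  have hbound : Continuous fun y' : P.Pair =>
      ‖P.costate y - P.costate y'‖ * B + ‖P.costate y'‖ * (L * ‖y.1 - y'.1‖) := by
    have := h.continuous_costate
    fun_prop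
  refine Metric.tendstoUniformlyOn_iff.2 fun ε hε => ?_
  filter_upwards [(hbound.tendsto y).eventually_lt_const (by simpa)] with y' hy' q hq
  exact (h.norm_hamiltonianAlong_sub_le y y' hq (hB q hq)).trans_lt hy'

theorem continuous_integral_avg_hamiltonianAlong (y : P.Pair) :
    Continuous fun μ : P.RelaxedInput => ∫ t, μ.avg (P.hamiltonianAlong y) t := by
  simpa using RelaxedInput.continuous_setIntegral_avg .univ (h.continuousOn_hamiltonianAlong y)

theorem tendstoUniformly_integral_avg_hamiltonianAlong (y : P.Pair) :
    TendstoUniformly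
      (fun (y' : P.Pair) (μ : P.RelaxedInput) => ∫ t, μ.avg (P.hamiltonianAlong y') t)
      (fun μ => ∫ t, μ.avg (P.hamiltonianAlong y) t) (𝓝 y) := by
  have huniform := RelaxedInput.tendstoUniformly_setIntegral_avg_of_tendstoUniformlyOn
    h.continuousOn_hamiltonianAlong (h.continuousOn_hamiltonianAlong y)
    (h.tendstoUniformlyOn_hamiltonianAlong y)
  simpa [Function.comp_def] using huniform.comp fun μ => (Set.univ, μ)

theorem continuous_firstVariation (y : P.Pair) : Continuous (P.firstVariation y) :=
  (h.continuous_integral_avg_hamiltonianAlong y).sub continuous_const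

theorem tendstoUniformly_firstVariation (y : P.Pair) :
    TendstoUniformly P.firstVariation (P.firstVariation y) (𝓝 y) := by
  have huniform := h.tendstoUniformly_integral_avg_hamiltonianAlong y
  have hself : Tendsto (fun y' : P.Pair => ∫ t, y'.2.avg (P.hamiltonianAlong y') t) (𝓝 y)
      (𝓝 (∫ t, y.2.avg (P.hamiltonianAlong y) t)) :=
    huniform.tendsto_comp (h.continuous_integral_avg_hamiltonianAlong y).continuousAt
      (continuous_snd.tendsto y)
  exact huniform.sub hself.tendstoUniformly_const

theorem lowerSemicontinuous_thetaH : LowerSemicontinuous P.thetaH :=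
  lowerSemicontinuous_iff_le_liminf.2 fun y => by
    rw [funext h.thetaH_eq_iInf]
    exact iInf_coe_le_liminf_of_tendstoUniformly (h.tendstoUniformly_firstVariation y)

theorem exists_le_firstVariation (y : P.Pair) : ∃ c, ∀ μ', c ≤ P.firstVariation y μ' := by
  obtain ⟨B, hB⟩ := P.isCompact_timeInput.exists_bound_of_continuousOn
    (h.continuousOn_hamiltonianAlong y)
  refine ⟨-(B * (volume : Measure P.Time).real Set.univ)
    - ∫ t, y.2.avg (P.hamiltonianAlong y) t, fun μ' => ?_⟩
  exact sub_le_sub_right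
    (abs_le.1 (norm_integral_le_of_norm_le_const (μ'.ae_norm_avg_le hB))).1 _

theorem thetaH_ne_bot (y : P.Pair) : P.thetaH y ≠ ⊥ := by
  obtain ⟨c, hc⟩ := h.exists_le_firstVariation y
  refine ne_bot_of_le_ne_bot (EReal.coe_ne_bot c) ?_
  rw [h.thetaH_eq_iInf]
  exact le_iInf fun μ' => EReal.coe_le_coe_iff.2 (hc μ')

/-! ### Optimality functions -/

theorem thetaH_nonpos (y : P.Pair) : P.thetaH y ≤ 0 := by
  rw [h.thetaH_eq_iInf]
  exact (iInf_le _ y.2).trans_eq (by rw [firstVariation_self, EReal.coe_zero])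

theorem thetaSample_nonpos {N : ℕ} {v : Fin N → RVec m} (hv : ∀ i, v i ∈ P.U) {y : P.Pair}
    (hy : P.IsEmpirical v y.2) : P.thetaSample v y ≤ 0 := by
  rw [h.thetaSample_eq_iInf hv hy]
  exact (iInf₂_le y.2 hy).trans_eq (by rw [firstVariation_self, EReal.coe_zero])

theorem isOptimalityFunction_thetaH :
    IsOptimalityFunction P.relaxedPairs P.cost P.thetaH where
  nonpos y _ := h.thetaH_nonpos y
  ne_bot y _ := h.thetaH_ne_bot y
  eq_zero y hy hmin := by
    refine le_antisymm (h.thetaH_nonpos y) ?_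
    rw [h.thetaH_eq_iInf]
    refine le_iInf fun μ' => EReal.coe_nonneg.2 (h.firstVariation_nonneg hy fun ε => ?_)
    exact EReal.coe_le_coe_iff.1 (isMinOn_iff.1 hmin (trajectory (y.2.mix μ' ε), y.2.mix μ' ε)
      (h.isTrajectory_trajectory _))

theorem isOptimalityFunction_thetaSample {N : ℕ} {v : Fin N → RVec m} (hv : ∀ i, v i ∈ P.U) :
    IsOptimalityFunction (P.empiricalPairs v) P.cost (P.thetaSample v) where
  nonpos _ hy := h.thetaSample_nonpos hv hy.2
  ne_bot y hy := ne_bot_of_le_ne_bot (h.thetaH_ne_bot y) (h.thetaH_le_thetaSample hv hy.2)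
  eq_zero y hy hmin := by
    refine le_antisymm (h.thetaSample_nonpos hv hy.2) ?_
    rw [h.thetaSample_eq_iInf hv hy.2]
    refine le_iInf₂ fun μ' hμ' => EReal.coe_nonneg.2 (h.firstVariation_nonneg hy.1 fun ε => ?_)
    exact EReal.coe_le_coe_iff.1 (isMinOn_iff.1 hmin (trajectory (y.2.mix μ' ε), y.2.mix μ' ε)
      ⟨h.isTrajectory_trajectory _, hy.2.mix hμ' ε⟩)

/-! ### Epi-convergence -/

theorem mem_relaxedPairs_of_tendsto {v : (N : ℕ) → Fin N → RVec m} {k : ℕ → ℕ}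
    {a : ℕ → P.Pair} {y : P.Pair} (ha : Tendsto a atTop (𝓝 y))
    (hmem : ∀ j, a j ∈ P.empiricalPairs (v (k j))) :
    y ∈ P.relaxedPairs :=
  h.isClosed_relaxedPairs.mem_of_tendsto ha (.of_forall fun j => (hmem j).1)

theorem thetaH_le_liminf {θ : ℕ → P.Pair → EReal} {a : ℕ → P.Pair} {y : P.Pair}
    (ha : Tendsto a atTop (𝓝 y)) (hle : ∀ j, P.thetaH (a j) ≤ θ j (a j)) :
    P.thetaH y ≤ liminf (fun j => θ j (a j)) atTop :=
  calc P.thetaH y ≤ liminf P.thetaH (𝓝 y) := h.lowerSemicontinuous_thetaH.le_liminf y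
    _ ≤ liminf (P.thetaH ∘ a) atTop := liminf_le_liminf_of_le ha
    _ ≤ liminf (fun j => θ j (a j)) atTop := liminf_le_liminf (.of_forall hle)

variable {v : (N : ℕ) → Fin N → RVec m} (hv : AsymptoticallyDense v P.U)
include hv

theorem limsup_thetaSample_le {k : ℕ → ℕ} (hk : Tendsto k atTop atTop) {a : ℕ → P.Pair}
    {y : P.Pair} (ha : Tendsto a atTop (𝓝 y))
    (hemp : ∀ᶠ j in atTop, P.IsEmpirical (v (k j)) (a j).2) :
    limsup (fun j => P.thetaSample (v (k j)) (a j)) atTop ≤ P.thetaH y := by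
  rw [h.thetaH_eq_iInf]
  refine le_iInf fun μ' => ?_
  obtain ⟨b, hb, -, hbμ'⟩ := exists_isEmpirical_tendsto hv μ'
  have hlim : Tendsto (fun j => P.firstVariation (a j) (b (k j))) atTop
      (𝓝 (P.firstVariation y μ')) :=
    TendstoUniformly.tendsto_comp
      (fun V hV => ha.eventually (h.tendstoUniformly_firstVariation y V hV))
      (h.continuous_firstVariation y).continuousAt (hbμ'.comp hk)
  rw [← ((continuous_coe_real_ereal.tendsto _).comp hlim).limsup_eq]
  refine limsup_le_limsup ?_ (by isBoundedDefault) (by isBoundedDefault)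
  filter_upwards [hemp] with j hj
  rw [h.thetaSample_eq_iInf (hv.mem _) hj]
  exact iInf₂_le (b (k j)) (hb _ (isEmpirical_iff.1 hj).1)

theorem exists_tendsto_empiricalPairs {y : P.Pair} (hy : y ∈ P.relaxedPairs) :
    ∃ a : ℕ → P.Pair, (∀ᶠ N in atTop, a N ∈ P.empiricalPairs (v N)) ∧
      (∀ N, ∀ t, Set.range (v N) ⊆ ((a N).2.kernel t).support) ∧ Tendsto a atTop (𝓝 y) := by
  obtain ⟨b, hb, hfull, hlim⟩ := exists_isEmpirical_tendsto hv y.2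
  refine ⟨fun N => (trajectory (b N), b N), ?_, hfull, ?_⟩
  · filter_upwards [eventually_gt_atTop 0] with N hN
      using ⟨h.isTrajectory_trajectory (b N), hb N hN⟩
  · refine Tendsto.prodMk_nhds ?_ hlim
    rw [h.eq_trajectory hy]
    exact (h.continuous_trajectory.tendsto y.2).comp hlim

theorem epiConverges_cost : EpiConverges (fun N => P.empiricalPairs (v N)) (fun _ => P.cost)
    P.relaxedPairs P.cost where
  recovery y hy := by
    obtain ⟨a, hmem, -, ha⟩ := h.exists_tendsto_empiricalPairs hv hy
    exact ⟨a, hmem, ha, ((h.continuous_cost.tendsto y).comp ha).limsup_eq.le⟩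
  lower _ _ _ y hmem ha := ⟨h.mem_relaxedPairs_of_tendsto ha hmem,
    ((h.continuous_cost.tendsto y).comp ha).liminf_eq.ge⟩

theorem epiConverges_thetaSample : EpiConverges (fun N => P.empiricalPairs (v N))
    (fun N => P.thetaSample (v N)) P.relaxedPairs P.thetaH where
  recovery y hy := by
    obtain ⟨a, hmem, -, ha⟩ := h.exists_tendsto_empiricalPairs hv hy
    exact ⟨a, hmem, ha, h.limsup_thetaSample_le hv tendsto_id ha (hmem.mono fun N hN => hN.2)⟩
  lower k _ a y hmem ha := ⟨h.mem_relaxedPairs_of_tendsto ha hmem,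
    h.thetaH_le_liminf ha fun j => h.thetaH_le_thetaSample (hv.mem (k j)) (hmem j).2⟩

theorem epiConverges_thetaNH : EpiConverges (fun N => P.empiricalPairs (v N))
    (fun _ => P.thetaNH) P.relaxedPairs P.thetaH where
  recovery y hy := by
    obtain ⟨a, hmem, hfull, ha⟩ := h.exists_tendsto_empiricalPairs hv hy
    have hle : ∀ᶠ N in atTop, P.thetaNH (a N) ≤ P.thetaSample (v N) (a N) := by
      filter_upwards [hmem] with N hN
        using h.thetaNH_le_thetaSample (hv.mem N) hN.2 (.of_forall (hfull N))
    exact ⟨a, hmem, ha, (limsup_le_limsup hle).trans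
      (h.limsup_thetaSample_le hv tendsto_id ha (hmem.mono fun N hN => hN.2))⟩
  lower k _ a y hmem ha := ⟨h.mem_relaxedPairs_of_tendsto ha hmem,
    h.thetaH_le_liminf ha fun j => h.thetaH_le_thetaNH (a j)⟩

theorem consistentApproximations :
    ConsistentApproximations (fun N => P.empiricalPairs (v N)) (fun _ => P.cost)
      (fun N => P.thetaSample (v N)) P.relaxedPairs P.cost P.thetaH where
  optimality_approx N := h.isOptimalityFunction_thetaSample (hv.mem N)
  optimality_limit := h.isOptimalityFunction_thetaH
  epi := h.epiConverges_cost hv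
  upper _ hk _ _ hmem ha :=
    h.limsup_thetaSample_le hv hk.tendsto_atTop ha (.of_forall fun j => (hmem j).2)

end LipschitzC1InState

end ControlProblem

theorem mainTheorem3_general {n m : ℕ} (P : ControlProblem n m) {L : ℝ}
    (h : P.LipschitzC1InState L) {Ω : Type*} [MeasurableSpace Ω] (Pr : Measure Ω)
    (ν : Measure (RVec m)) [IsProbabilityMeasure ν] (hν : ν.support = P.U)
    (v : (N : ℕ) → Fin N → Ω → RVec m)
    (hlaw : ∀ N i, HasLaw (v N i) ν Pr) (hindep : ∀ N, iIndepFun (v N) Pr) :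
    (∀ μ : P.RelaxedInput, ∃! x, P.IsTrajectory x μ) ∧
    (∀ y : P.Pair, ∃! p, P.IsCostate y p) ∧
    ∀ᵐ ω ∂Pr,
      EpiConverges (fun N => P.empiricalPairs fun i => v N i ω) (fun _ => P.thetaNH)
        P.relaxedPairs P.thetaH ∧
      EpiConverges (fun N => P.empiricalPairs fun i => v N i ω)
        (fun N => P.thetaSample fun i => v N i ω) P.relaxedPairs P.thetaH ∧
      ConsistentApproximations (fun N => P.empiricalPairs fun i => v N i ω)
        (fun _ => P.cost) (fun N => P.thetaSample fun i => v N i ω)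
        P.relaxedPairs P.cost P.thetaH := by
  refine ⟨h.existsUnique_isTrajectory, h.existsUnique_isCostate, ?_⟩
  have hdense := ae_asymptoticallyDense hlaw hindep
  rw [hν] at hdense
  filter_upwards [hdense] with ω hω
  exact ⟨h.epiConverges_thetaNH hω, h.epiConverges_thetaSample hω, h.consistentApproximations hω⟩

end

theorem mainTheorem3 {n m : ℕ} (P : ControlProblem n m) (hP : P.LipschitzC1)
    {Ω : Type*} [MeasurableSpace Ω] (Pr : Measure Ω) [IsProbabilityMeasure Pr]
    (ν : Measure (RVec m)) [IsProbabilityMeasure ν] (hν : ν.support = P.U)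
    (v : (N : ℕ) → Fin N → Ω → RVec m)
    (hlaw : ∀ N i, HasLaw (v N i) ν Pr) (hindep : ∀ N, iIndepFun (v N) Pr) :
    (∀ μ : P.RelaxedInput, ∃! x, P.IsTrajectory x μ) ∧
    (∀ y : P.Pair, ∃! p, P.IsCostate y p) ∧
    ∀ᵐ ω ∂Pr,
      EpiConverges (fun N => P.empiricalPairs fun i => v N i ω) (fun _ => P.thetaNH)
        P.relaxedPairs P.thetaH ∧
      EpiConverges (fun N => P.empiricalPairs fun i => v N i ω)
        (fun N => P.thetaSample fun i => v N i ω) P.relaxedPairs P.thetaH ∧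
      ConsistentApproximations (fun N => P.empiricalPairs fun i => v N i ω)
        (fun _ => P.cost) (fun N => P.thetaSample fun i => v N i ω)
        P.relaxedPairs P.cost P.thetaH := by
  obtain ⟨L, h⟩ := hP.exists_lipschitzC1InState
  exact mainTheorem3_general P h Pr ν hν v hlaw hindep
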